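/- Let $p \in [1,\infty)$ and $T>0$. Processes are indexed by $[0,T]$ and defined on a filtered probability space $(\Omega,\mathcal F,(\mathcal F_t)_{t\in[0,T]},\mathbb P)$ satisfying the usual conditions; write $\mathbb E_s[\,\cdot\,]=\mathbb E[\,\cdot\,|\mathcal F_s]$. A partition $\mathcal P$ of $[s,t]$ is a finite sequence $s=t_0<t_1<\dots<t_n=t$, and $[u,v]\in\mathcal P$ means that $u,v$ are consecutive points of $\mathcal P$. For a process $Y$, let $$\|Y\|_{p,q,r,[0,T]} := \Big(\sup_{\mathcal P\subset[0,T]}\sum_{[u,v]\in\mathcal P}\big\|\mathbb E_u[|Y_v-Y_u|^q]\big\|_{L^r}^{p/q}\Big)^{1/p},$$ and let $V^pL^{q,r}$ be the space of processes $Y$ which are almost surely càdlàg, with $Y_0\in L^q$ and $\|Y\|_{p,q,r,[0,T]}<\infty$. For a càdlàg adapted process $V$, with the convention $V_{0-}:=V_0$, let $$\rho_{s,t}(V):=\sup_{s\le\sigma\le\tau\le t}\big\|\mathbb E[\,|V_\tau-V_{\sigma-}|\,|\mathcal F_\sigma]\big\|_{L^\infty}$$ (supremum over all stopping times $\sigma,\tau$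 with $s\le\sigma\le\tau\le t$), let $$\|V\|_{\mathrm{BMO}^{p\text{-var}},[0,T]}:=\Big(\sup_{\mathcal P\subset[0,T]}\sum_{[s,t]\in\mathcal P}\rho_{s,t}(V)^p\Big)^{1/p},$$ and let $\mathrm{BMO}^{p\text{-var}}$ be the class of càdlàg adapted processes for which this is finite. **Proposition.** If $V\in\mathrm{BMO}^{p\text{-var}}$ is a one-dimensional process with $V_0\in L^\infty$, then $\exp(V)\in V^pL^{q,r}$ for any $q,r\in[1,\infty)$. Moreover, if $q,\tilde q,r\in[1,\infty)$ are such that $\tilde q r<q$, and if $\widetilde V\in\mathrm{BMO}^{p\text{-var}}$ is another one-dimensional process (on the same filtered probability space) with $\widetilde V_0\in L^\infty$, then $$\big\|\exp(V)-\exp(\widetilde V)\big\|_{p,\tilde q,r,[0,T]}\le C\big(\|V_0-\widetilde V_0\|_{L^q}+\|V-\widetilde V\|_{p,q,r,[0,T]}\big),$$ where the constant $C>0$ depends only on $p,q,\tilde q,r$ and on upper bounds for $\|V_0\|_{L^\infty}$, $\|\widetilde V_0\|_{L^\infty}$, $\|V\|_{\mathrm{BMO}^{p\text{-var}},[0,T]}$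 and $\|\widetilde V\|_{\mathrm{BMO}^{p\text{-var}},[0,T]}$. -/

import Mathlib

open MeasureTheory Set Filter Topology
open scoped ENNReal NNReal

universe u

noncomputable section

namespace RoughBMO

section Paths

variable {ι E : Type*}

/-- Right-continuous paths with left limits. -/
def IsCadlag [LinearOrder ι] [TopologicalSpace ι] [TopologicalSpace E] (f : ι → E) : Prop :=
  ∀ t, ContinuousWithinAt f (Ici t) t ∧ ∃ l, Tendsto f (𝓝[<] t) (𝓝 l)

/-- The increments `δY_{s,t} = Y_t - Y_s` of a process, as a two-parameter process. -/
def increment {Ω : Type*} [Sub E] (Y : ι → Ω → E) (s t : ι) (ω : Ω) : E :=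
  Y t ω - Y s ω

/-- For a two-parameter function `w ≥ 0`, the quantity
`(sup_𝒫 ∑_{[u,v] ∈ 𝒫} w(u,v)^p)^{1/p}`, the supremum being taken over all partitions
`s = t_0 < t_1 < ⋯ < t_n = t` of `[s,t]`. -/
def pVariation [LinearOrder ι] (p : ℝ) (w : ι → ι → ℝ≥0∞) (s t : ι) : ℝ≥0∞ :=
  (⨆ (n : ℕ) (x : Fin (n + 1) → ι) (_ : StrictMono x) (_ : x 0 = s) (_ : x (Fin.last n) = t),
    ∑ i : Fin n, w (x i.castSucc) (x i.succ) ^ p) ^ (1 / p)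

end Paths

section Processes

variable {ι Ω E : Type*} [LinearOrder ι] {mΩ : MeasurableSpace Ω}

/-- The usual conditions: the filtration is right-continuous and every (subset of a)
`P`-null set belongs to every `𝓕 t`; in particular, `P` is complete. -/
structure UsualConditions (𝓕 : Filtration ι mΩ) (P : Measure Ω) : Prop where
  rightCont : 𝓕.IsRightContinuous
  complete : ∀ (t : ι) (A : Set Ω), P A = 0 → MeasurableSet[𝓕 t] A

/-- `‖Y‖_{q,r,𝒢} = ‖E[|Y|^q | 𝒢]‖_{L^r}^{1/q}`, with values in `[0,∞]`. -/
def condNorm [ENorm E] (P : Measure Ω) (q : ℝ) (r : ℝ≥0∞) (𝒢 : MeasurableSpace Ω)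
    (Y : Ω → E) : ℝ≥0∞ :=
  eLpNorm (condLExp 𝒢 P fun ω => ‖Y ω‖ₑ ^ q) r P ^ (1 / q)

/-- `‖F‖_{p,q,r,[s,t]}` for a two-parameter process `F`. -/
def pqrNorm [ENorm E] (𝓕 : Filtration ι mΩ) (P : Measure Ω) (p q : ℝ) (r : ℝ≥0∞)
    (F : ι → ι → Ω → E) (s t : ι) : ℝ≥0∞ :=
  pVariation p (fun u v => condNorm P q r (𝓕 u) (F u v)) s t

/-- The modulus of mean variation `ρ_{s,t}(V) = sup ‖E_σ[|V_τ - V_{σ-}|]‖_{L^∞}`, over all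
stopping times `s ≤ σ ≤ τ ≤ t`. At the smallest time `0` of the index set, `Function.leftLim`
gives `V_{0-} = V_0`. -/
def meanVariation [NormedAddCommGroup E] (𝓕 : Filtration ι mΩ) (P : Measure Ω)
    (V : ι → Ω → E) (s t : ι) : ℝ≥0∞ :=
  ⨆ (σ : Ω → ι) (τ : Ω → ι)
    (hσ : IsStoppingTime 𝓕 fun ω => (σ ω : WithTop ι))
    (_ : IsStoppingTime 𝓕 fun ω => (τ ω : WithTop ι))
    (_ : ∀ ω, s ≤ σ ω ∧ σ ω ≤ τ ω ∧ τ ω ≤ t),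
    eLpNorm (condLExp hσ.measurableSpace P
      fun ω => ‖V (τ ω) ω - Function.leftLim (fun u => V u ω) (σ ω)‖ₑ) ∞ P

/-- `‖V‖_{BMO^{p-var},[s,t]}`. -/
def bmoVarNorm [NormedAddCommGroup E] (𝓕 : Filtration ι mΩ) (P : Measure Ω) (p : ℝ)
    (V : ι → Ω → E) (s t : ι) : ℝ≥0∞ :=
  pVariation p (meanVariation 𝓕 P V) s t

/-- The class `BMO^{p-var}` over `[s,t]`, where `s` and `t` are the end points of the time
interval. -/
structure MemBMOVar [TopologicalSpace ι] [NormedAddCommGroup E] (𝓕 : Filtration ι mΩ)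
    (P : Measure Ω) (p : ℝ) (V : ι → Ω → E) (s t : ι) : Prop where
  adapted : StronglyAdapted 𝓕 V
  cadlag : ∀ᵐ ω ∂P, IsCadlag fun u => V u ω
  norm_lt_top : bmoVarNorm 𝓕 P p V s t < ∞

/-- The space `V^p L^{q,r}` over `[s,t]`, where `s` and `t` are the end points of the time
interval. -/
structure MemVpLqr [TopologicalSpace ι] [NormedAddCommGroup E] (𝓕 : Filtration ι mΩ)
    (P : Measure Ω) (p q : ℝ) (r : ℝ≥0∞) (Y : ι → Ω → E) (s t : ι) : Prop where
  measurable : ∀ u, StronglyMeasurable (Y u)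
  cadlag : ∀ᵐ ω ∂P, IsCadlag fun u => Y u ω
  initial : MemLp (Y s) (ENNReal.ofReal q) P
  norm_lt_top : pqrNorm 𝓕 P p q r (increment Y) s t < ∞

end Processes

/-- The initial time `0` of `[0,T]`. -/
def startTime {T : ℝ} (hT : 0 < T) : Icc (0 : ℝ) T := ⟨0, left_mem_Icc.2 hT.le⟩

/-- The final time `T` of `[0,T]`. -/
def endTime {T : ℝ} (hT : 0 < T) : Icc (0 : ℝ) T := ⟨T, right_mem_Icc.2 hT.le⟩

end RoughBMO

end

/-!
A process whose modulus of mean variation is at most `ρ` has conditional exponential moments of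
small order, uniformly in the conditioning (John–Nirenberg): consider the successive times at which
it has moved by a fixed multiple of `ρ`; conditionally on each of them, the probability of reaching
the next one is bounded away from `1`.

For a process in `BMO^{p-var}` the order is arbitrary. Since `ρ_{s,t}(V)^p` is dominated by a
superadditive function, `[0,T]` splits into boundedly many intervals whose interiors have small
mean variation, and the jumps at the cut points are bounded by the modulus itself. Hence `exp |δV|`
has conditional moments of all orders, bounded in terms of the `BMO^{p-var}` norm.

Factoring out `exp V_u`, the increment over `[u,v]` of `exp V - exp V'` is bounded by
`exp |V_u| exp |V'_u|` times `exp |δV| exp |δV'| |δ(V - V')| + exp |δV'| |δV'| |V_u - V'_u|`.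
Hölder's inequality given `𝓕_u` for the increments and then without conditioning for the weight,
at the cost of the exponent `q > q' r`, bounds its norm, and Minkowski's inequality sums the bound
over the partition. The case `V' = 0` gives the membership of `exp V`.
-/

noncomputable section

namespace RoughBMO

section CondLExp

variable {Ω : Type*} {m m₀ : MeasurableSpace Ω} {P : Measure[m₀] Ω} {f g : Ω → ℝ≥0∞}

theorem condLExp_mul_of_measurable_left (hf : Measurable[m] f) (hg : AEMeasurable g P) :
    P⁻[f * g | m] =ᵐ[P] f * P⁻[g | m] := by
  by_cases hm : m ≤ m₀
  swap; · simp [condLExp_of_not_le hm]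
  by_cases hσ : SigmaFinite (P.trim hm)
  swap; · simp [condLExp_of_not_sigmaFinite hm hσ]
  have hE := measurable_condLExp' m P g
  have trim_eq : (P.withDensity P⁻[g | m]).trim hm = (P.withDensity g).trim hm := by
    refine @Measure.ext Ω m _ _ fun s hs => ?_
    rw [trim_measurableSet_eq hm hs, trim_measurableSet_eq hm hs, withDensity_apply _ (hm s hs),
      withDensity_apply _ (hm s hs), setLIntegral_condLExp hm P g hs]
  have setLIntegral_mul : ∀ {h : Ω → ℝ≥0∞}, AEMeasurable h P → ∀ s, MeasurableSet[m] s →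
      ∫⁻ ω in s, (f * h) ω ∂P = ∫⁻ ω in s, f ω ∂(P.withDensity h).trim hm := by
    intro h hh s hs
    rw [setLIntegral_trim hm hf hs, restrict_withDensity (hm s hs),
      lintegral_withDensity_eq_lintegral_mul₀ hh.restrict (hf.mono hm le_rfl).aemeasurable,
      mul_comm f h]
  refine (ae_eq_condLExp hm P _ (hf.mul (measurable_condLExp m P g)) fun s hs => ?_).symm
  rw [setLIntegral_mul hE.aemeasurable s hs, setLIntegral_mul hg s hs, trim_eq]

theorem condLExp_condLExp_of_le {m₁ m₂ : MeasurableSpace Ω} (hm₁₂ : m₁ ≤ m₂) (hm₂ : m₂ ≤ m₀)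
    [SigmaFinite (P.trim hm₂)] : P⁻[P⁻[f | m₂] | m₁] =ᵐ[P] P⁻[f | m₁] := by
  by_cases hσ : SigmaFinite (P.trim (hm₁₂.trans hm₂))
  swap; · simp [condLExp_of_not_sigmaFinite (hm₁₂.trans hm₂) hσ]
  refine ae_eq_condLExp (hm₁₂.trans hm₂) P f (measurable_condLExp _ _ _) fun s hs => ?_
  rw [setLIntegral_condLExp (hm₁₂.trans hm₂) P _ hs, setLIntegral_condLExp hm₂ P f (hm₁₂ s hs)]

theorem condLExp_le_condLExp_of_condLExp_le {m₁ m₂ : MeasurableSpace Ω} (hm₁₂ : m₁ ≤ m₂)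
    (hm₂ : m₂ ≤ m₀) [SigmaFinite (P.trim hm₂)] (h : P⁻[f | m₂] ≤ᵐ[P] g) :
    P⁻[f | m₁] ≤ᵐ[P] P⁻[g | m₁] :=
  (condLExp_condLExp_of_le hm₁₂ hm₂).symm.trans_le (condLExp_mono h)

theorem condLExp_le_of_forall_setLIntegral_le (hm : m ≤ m₀) [SigmaFinite (P.trim hm)]
    (hg : Measurable[m] g)
    (hfg : ∀ s, MeasurableSet[m] s → ∫⁻ ω in s, f ω ∂P ≤ ∫⁻ ω in s, g ω ∂P) :
    P⁻[f | m] ≤ᵐ[P] g := by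
  refine ae_le_of_ae_le_trim (hm := hm)
    (ae_le_of_forall_setLIntegral_le_of_sigmaFinite (measurable_condLExp m P f) fun s hs _ => ?_)
  rw [setLIntegral_condLExp_trim hm P f hs, setLIntegral_trim hm hg hs]
  exact hfg s hs

theorem condLExp_le_of_tendsto (hm : m ≤ m₀) [SigmaFinite (P.trim hm)] {F : ℕ → Ω → ℝ≥0∞}
    (hF : ∀ n, Measurable (F n)) (hlim : ∀ᵐ ω ∂P, Tendsto (fun n => F n ω) atTop (𝓝 (f ω)))
    (hg : Measurable[m] g) (hle : ∀ n, P⁻[F n | m] ≤ᵐ[P] g) : P⁻[f | m] ≤ᵐ[P] g := by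
  refine condLExp_le_of_forall_setLIntegral_le hm hg fun s hs => ?_
  calc ∫⁻ ω in s, f ω ∂P = ∫⁻ ω in s, liminf (fun n => F n ω) atTop ∂P :=
        lintegral_congr_ae ((ae_restrict_of_ae hlim).mono fun ω hω => hω.liminf_eq.symm)
    _ ≤ liminf (fun n => ∫⁻ ω in s, F n ω ∂P) atTop := lintegral_liminf_le hF
    _ ≤ ∫⁻ ω in s, g ω ∂P := by
        refine liminf_le_of_le (by isBoundedDefault) fun b hb => ?_
        obtain ⟨n, hn⟩ := hb.exists
        rw [← setLIntegral_condLExp hm P (F n) hs] at hn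
        exact hn.trans (lintegral_mono_ae (ae_restrict_of_ae (hle n)))

theorem ae_eq_zero_of_condLExp_eq_zero (hm : m ≤ m₀) [SigmaFinite (P.trim hm)]
    (hf : AEMeasurable f P) : ∀ᵐ ω ∂P, P⁻[f | m] ω = 0 → f ω = 0 := by
  have hs : MeasurableSet[m] {ω | P⁻[f | m] ω = 0} :=
    measurable_condLExp m P f (measurableSet_singleton 0)
  refine (ae_restrict_iff' (hm _ hs)).1 ?_
  refine (lintegral_eq_zero_iff' hf.restrict).1 ?_
  rw [← setLIntegral_condLExp hm P f hs]
  exact (setLIntegral_congr_fun (hm _ hs) fun ω hω => hω).trans lintegral_zero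

theorem mul_le_of_young {a b : ℝ} (hab : a.HolderConjugate b) {x y u w : ℝ≥0∞}
    (hx : u = 0 → x = 0) (hy : w = 0 → y = 0) (huw : u * w ≠ ∞) :
    x * y ≤ u * w * u⁻¹ ^ a / ENNReal.ofReal a * x ^ a +
      u * w * w⁻¹ ^ b / ENNReal.ofReal b * y ^ b := by
  rcases eq_or_ne u 0 with hu | hu
  · simp [hx hu]
  rcases eq_or_ne w 0 with hw | hw
  · simp [hy hw]
  have hu_top : u ≠ ∞ := fun h => huw (by simp [h, hw])
  have hw_top : w ≠ ∞ := fun h => huw (by simp [h, hu])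
  calc x * y = u * w * (u⁻¹ * x * (w⁻¹ * y)) := by
        rw [show u * w * (u⁻¹ * x * (w⁻¹ * y)) = u * u⁻¹ * (w * w⁻¹) * (x * y) by ring,
          ENNReal.mul_inv_cancel hu hu_top, ENNReal.mul_inv_cancel hw hw_top, one_mul, one_mul]
    _ ≤ u * w * ((u⁻¹ * x) ^ a / ENNReal.ofReal a + (w⁻¹ * y) ^ b / ENNReal.ofReal b) := by
        gcongr
        exact ENNReal.young_inequality _ _ hab
    _ = _ := by
        rw [ENNReal.mul_rpow_of_nonneg _ _ hab.nonneg,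
          ENNReal.mul_rpow_of_nonneg _ _ hab.symm.nonneg]
        simp only [div_eq_mul_inv]
        ring

theorem mul_inv_rpow_div_mul_rpow_le {a : ℝ} (ha : 0 < a) (c u d : ℝ≥0∞) :
    c * (u ^ (1 / a))⁻¹ ^ a / d * u ≤ c / d := by
  have hu : (u ^ (1 / a))⁻¹ ^ a * u ≤ 1 := by
    rw [ENNReal.inv_rpow, one_div, ENNReal.rpow_inv_rpow ha.ne']
    exact ENNReal.inv_mul_le_one u
  calc c * (u ^ (1 / a))⁻¹ ^ a / d * u = c / d * ((u ^ (1 / a))⁻¹ ^ a * u) := by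
        simp only [div_eq_mul_inv]; ring
    _ ≤ c / d := mul_le_of_le_one_right' hu

theorem condLExp_le_linear_combination {k h c₁ c₂ : Ω → ℝ≥0∞} (hm : m ≤ m₀)
    [SigmaFinite (P.trim hm)] (hh : Measurable[m] h) (hc₁ : Measurable[m] c₁)
    (hc₂ : Measurable[m] c₂) (hf : AEMeasurable f P) (hg : AEMeasurable g P)
    (hk : k ≤ᵐ[P] h + (c₁ * f + c₂ * g)) :
    P⁻[k | m] ≤ᵐ[P] h + (c₁ * P⁻[f | m] + c₂ * P⁻[g | m]) := by
  filter_upwards [condLExp_mono (mΩ := m) hk,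
    condLExp_add_left (mΩ := m) (P := P) (c₁ * f + c₂ * g) (hh.mono hm le_rfl).aemeasurable,
    condLExp_add_left (mΩ := m) (c₂ * g) ((hc₁.mono hm le_rfl).aemeasurable.mul hf),
    condLExp_mul_of_measurable_left hc₁ hf, condLExp_mul_of_measurable_left hc₂ hg]
    with ω hle hadd hadd' hmul₁ hmul₂
  simpa only [hadd, hadd', hmul₁, hmul₂, Pi.add_apply, Pi.mul_apply, condLExp_eq_self hm P hh]
    using hle

theorem condLExp_mul_le_rpow_mul_rpow {a b : ℝ} (hab : a.HolderConjugate b) (hm : m ≤ m₀)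
    [SigmaFinite (P.trim hm)] (hf : AEMeasurable f P) (hg : AEMeasurable g P) :
    P⁻[f * g | m] ≤ᵐ[P] fun ω =>
      P⁻[fun ω => f ω ^ a | m] ω ^ (1 / a) * P⁻[fun ω => g ω ^ b | m] ω ^ (1 / b) := by
  set F : Ω → ℝ≥0∞ := fun ω => f ω ^ a
  set G : Ω → ℝ≥0∞ := fun ω => g ω ^ b
  set U : Ω → ℝ≥0∞ := fun ω => P⁻[F | m] ω ^ (1 / a) with hUF
  set W : Ω → ℝ≥0∞ := fun ω => P⁻[G | m] ω ^ (1 / b) with hWG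
  change P⁻[f * g | m] ≤ᵐ[P] U * W
  have hF : AEMeasurable F P := hf.pow_const a
  have hG : AEMeasurable G P := hg.pow_const b
  have hU : Measurable[m] U := (measurable_condLExp m P F).pow_const _
  have hW : Measurable[m] W := (measurable_condLExp m P G).pow_const _
  have hUW : Measurable[m] (U * W) := hU.mul hW
  let h : Ω → ℝ≥0∞ := ((U * W) ⁻¹' {∞}).indicator fun _ => ∞
  let c₁ : Ω → ℝ≥0∞ := fun ω => (U * W) ω * (U ω)⁻¹ ^ a / ENNReal.ofReal a
  let c₂ : Ω → ℝ≥0∞ := fun ω => (U * W) ω * (W ω)⁻¹ ^ b / ENNReal.ofReal b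
  have young : f * g ≤ᵐ[P] h + (c₁ * F + c₂ * G) := by
    filter_upwards [ae_eq_zero_of_condLExp_eq_zero hm hF, ae_eq_zero_of_condLExp_eq_zero hm hG]
      with ω hFω hGω
    by_cases hω : (U * W) ω = ∞
    · have h_top : h ω = ∞ := indicator_of_mem (s := (U * W) ⁻¹' {∞}) hω _
      simp only [Pi.add_apply, h_top, top_add, le_top]
    refine (mul_le_of_young hab (fun hu => ?_) (fun hw => ?_) hω).trans le_add_self
    · rw [hUF, ENNReal.rpow_eq_zero_iff_of_pos (one_div_pos.2 hab.pos)] at hu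
      exact (ENNReal.rpow_eq_zero_iff_of_pos hab.pos).1 (hFω hu)
    · rw [hWG, ENNReal.rpow_eq_zero_iff_of_pos (one_div_pos.2 hab.symm.pos)] at hw
      exact (ENNReal.rpow_eq_zero_iff_of_pos hab.symm.pos).1 (hGω hw)
  filter_upwards [condLExp_le_linear_combination hm
    (measurable_const.indicator (hUW (measurableSet_singleton ∞)))
    ((hUW.mul (hU.inv.pow_const a)).div_const _) ((hUW.mul (hW.inv.pow_const b)).div_const _)
    hF hG young] with ω hle
  by_cases hω : (U * W) ω = ∞
  · exact le_top.trans_eq hω.symm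
  have h_zero : h ω = 0 := indicator_of_notMem (s := (U * W) ⁻¹' {∞}) hω _
  calc P⁻[f * g | m] ω ≤ h ω + (c₁ ω * P⁻[F | m] ω + c₂ ω * P⁻[G | m] ω) := hle
    _ = c₁ ω * P⁻[F | m] ω + c₂ ω * P⁻[G | m] ω := by rw [h_zero, zero_add]
    _ ≤ (U * W) ω / ENNReal.ofReal a + (U * W) ω / ENNReal.ofReal b :=
        add_le_add (mul_inv_rpow_div_mul_rpow_le hab.pos _ _ _)
          (mul_inv_rpow_div_mul_rpow_le hab.symm.pos _ _ _)
    _ = (U * W) ω := by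
        rw [div_eq_mul_inv, div_eq_mul_inv, ← mul_add, hab.inv_add_inv_ennreal, mul_one]

end CondLExp

section CondLpNorm

variable {Ω : Type*} {m m₀ : MeasurableSpace Ω} {P : Measure[m₀] Ω} {f g : Ω → ℝ≥0∞}
  {p q r : ℝ}

/-- The conditional `L^q` norm `E[f^q | m]^{1/q}` of a `[0,∞]`-valued function. -/
def condLpNorm (P : Measure[m₀] Ω) (q : ℝ) (m : MeasurableSpace Ω) (f : Ω → ℝ≥0∞) (ω : Ω) :
    ℝ≥0∞ :=
  P⁻[fun ω => f ω ^ q | m] ω ^ (1 / q)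

theorem measurable_condLpNorm (P : Measure[m₀] Ω) (q : ℝ) (m : MeasurableSpace Ω)
    (f : Ω → ℝ≥0∞) : Measurable[m] (condLpNorm P q m f) :=
  (measurable_condLExp m P _).pow_const _

theorem condLpNorm_rpow (hq : q ≠ 0) (ω : Ω) :
    condLpNorm P q m f ω ^ q = P⁻[fun ω => f ω ^ q | m] ω := by
  rw [condLpNorm, one_div, ENNReal.rpow_inv_rpow hq]

theorem condLpNorm_mono (hq : 0 ≤ q) (hfg : f ≤ᵐ[P] g) :
    condLpNorm P q m f ≤ᵐ[P] condLpNorm P q m g := by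
  filter_upwards [condLExp_mono (mΩ := m)
    (hfg.mono fun ω hω => ENNReal.rpow_le_rpow hω hq)] with ω hω
  exact ENNReal.rpow_le_rpow hω (by positivity)

theorem condLpNorm_congr (hfg : f =ᵐ[P] g) : condLpNorm P q m f =ᵐ[P] condLpNorm P q m g := by
  filter_upwards [condLExp_congr_ae (mΩ := m) (hfg.fun_comp (· ^ q))] with ω hω
  exact congrArg (· ^ (1 / q)) hω

theorem condLpNorm_mul_of_measurable_left (hq : 0 < q) (hf : Measurable[m] f)
    (hg : AEMeasurable g P) :
    condLpNorm P q m (f * g) =ᵐ[P] f * condLpNorm P q m g := by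
  have hmul : (fun ω => (f * g) ω ^ q) = (fun ω => f ω ^ q) * fun ω => g ω ^ q :=
    funext fun ω => ENNReal.mul_rpow_of_nonneg _ _ hq.le
  filter_upwards [condLExp_mul_of_measurable_left (hf.pow_const q) (hg.pow_const q)] with ω hω
  rw [condLpNorm, hmul, hω, Pi.mul_apply, Pi.mul_apply,
    ENNReal.mul_rpow_of_nonneg _ _ (by positivity), one_div, ENNReal.rpow_rpow_inv hq.ne',
    condLpNorm, one_div]

theorem condLpNorm_mul_le (hpqr : p.HolderTriple q r) (hm : m ≤ m₀) [SigmaFinite (P.trim hm)]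
    (hf : AEMeasurable f P) (hg : AEMeasurable g P) :
    condLpNorm P r m (f * g) ≤ᵐ[P] condLpNorm P p m f * condLpNorm P q m g := by
  have hr := hpqr.pos'
  have hmul : (fun ω => (f * g) ω ^ r) = (fun ω => f ω ^ r) * fun ω => g ω ^ r :=
    funext fun ω => ENNReal.mul_rpow_of_nonneg _ _ hr.le
  have rpow_rpow : ∀ (a : ℝ) (h : Ω → ℝ≥0∞),
      (fun ω => (h ω ^ r) ^ (a / r)) = fun ω => h ω ^ a := fun a h => by
    simp only [← ENNReal.rpow_mul, mul_div_cancel₀ a hr.ne']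
  filter_upwards [condLExp_mul_le_rpow_mul_rpow hpqr.holderConjugate_div_div hm (hf.pow_const r)
    (hg.pow_const r)] with ω hω
  rw [← hmul, rpow_rpow, rpow_rpow] at hω
  calc condLpNorm P r m (f * g) ω
      ≤ (P⁻[fun ω => f ω ^ p | m] ω ^ (1 / (p / r)) * P⁻[fun ω => g ω ^ q | m] ω ^ (1 / (q / r))) ^
          (1 / r) := ENNReal.rpow_le_rpow hω (by positivity)
    _ = condLpNorm P p m f ω * condLpNorm P q m g ω := by
        rw [ENNReal.mul_rpow_of_nonneg _ _ (by positivity), ← ENNReal.rpow_mul,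
          ← ENNReal.rpow_mul, condLpNorm, condLpNorm]
        congr 2 <;> field_simp

theorem condLpNorm_add_le (hq : 1 ≤ q) (hf : AEMeasurable f P) :
    condLpNorm P q m (f + g) ≤ᵐ[P] fun ω => 2 * (condLpNorm P q m f ω + condLpNorm P q m g ω) := by
  have hq₀ : 0 < q := zero_lt_one.trans_le hq
  have rpow_add_le : (fun ω => (f + g) ω ^ q) ≤
      (2 ^ q : ℝ≥0∞) • ((fun ω => f ω ^ q) + fun ω => g ω ^ q) := fun ω =>
    (ENNReal.rpow_add_le_mul_rpow_add_rpow _ _ hq).trans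
      (mul_le_mul_left (ENNReal.rpow_le_rpow_of_exponent_le one_le_two (by linarith)) _)
  filter_upwards [condLExp_mono (mΩ := m) (P := P) (ae_of_all _ rpow_add_le),
    condLExp_smul' (mΩ := m) (P := P) ((fun ω => f ω ^ q) + fun ω => g ω ^ q)
      (show (2 ^ q : ℝ≥0∞) ≠ ∞ by finiteness),
    condLExp_add_left (mΩ := m) (fun ω => g ω ^ q) (hf.pow_const q)] with ω hle hsmul hadd
  rw [hsmul, Pi.smul_apply, hadd, Pi.add_apply, smul_eq_mul] at hle
  calc condLpNorm P q m (f + g) ω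
      ≤ (2 ^ q * (P⁻[fun ω => f ω ^ q | m] ω + P⁻[fun ω => g ω ^ q | m] ω)) ^ (1 / q) :=
        ENNReal.rpow_le_rpow hle (by positivity)
    _ = 2 * (P⁻[fun ω => f ω ^ q | m] ω + P⁻[fun ω => g ω ^ q | m] ω) ^ (1 / q) := by
        rw [ENNReal.mul_rpow_of_nonneg _ _ (by positivity), one_div, ENNReal.rpow_rpow_inv hq₀.ne']
    _ ≤ 2 * (condLpNorm P q m f ω + condLpNorm P q m g ω) := by
        gcongr
        exact ENNReal.rpow_add_le_add_rpow _ _ (by positivity) ((div_le_one hq₀).2 hq)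

theorem eLpNorm_condLpNorm (hm : m ≤ m₀) [SigmaFinite (P.trim hm)] (hq : 0 < q) :
    eLpNorm (condLpNorm P q m f) (ENNReal.ofReal q) P = eLpNorm f (ENNReal.ofReal q) P := by
  have hq_ne : ENNReal.ofReal q ≠ 0 := (ENNReal.ofReal_pos.2 hq).ne'
  simp only [eLpNorm_eq_lintegral_rpow_enorm_toReal hq_ne ENNReal.ofReal_ne_top,
    ENNReal.toReal_ofReal hq.le, enorm_eq_self, condLpNorm_rpow hq.ne', lintegral_condLExp hm]

theorem eLpNorm_le_of_ae_le_const [IsProbabilityMeasure P] {c e : ℝ≥0∞} (hf : f ≤ᵐ[P] fun _ => c) :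
    eLpNorm f e P ≤ c :=
  (eLpNorm_le_of_ae_enorm_bound (f := f) (C := c) hf).trans_eq
    (by rw [measure_univ, ENNReal.one_rpow, smul_eq_mul, mul_one])

theorem condNorm_eq_eLpNorm_condLpNorm {E : Type*} [ENorm E] (hq : 0 < q) (hr : 0 ≤ r)
    (Y : Ω → E) :
    condNorm P q (ENNReal.ofReal r) m Y =
      eLpNorm (condLpNorm P q m fun ω => ‖Y ω‖ₑ) (ENNReal.ofReal (r * q)) P := by
  rw [condNorm, ENNReal.ofReal_mul hr, one_div,
    ← ENNReal.rpow_rpow_inv hq.ne' (eLpNorm (condLpNorm P q m _) _ P), ← eLpNorm_enorm_rpow _ hq]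
  simp only [enorm_eq_self, condLpNorm_rpow hq.ne']

end CondLpNorm

section Cadlag

variable {ι E : Type*} [LinearOrder ι] [TopologicalSpace ι] [NormedAddCommGroup E]
  {f : ι → E} {s t : ι}

theorem IsCadlag.continuous_comp {F G : Type*} [TopologicalSpace F] [TopologicalSpace G] {g : F → G}
    {f : ι → F} (hg : Continuous g) (hf : IsCadlag f) : IsCadlag fun t => g (f t) := fun t =>
  let ⟨right_cont, l, tendsto_left⟩ := hf t
  ⟨hg.continuousAt.comp_continuousWithinAt right_cont, g l, (hg.tendsto l).comp tendsto_left⟩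

theorem IsCadlag.tendsto_norm_sub (hf : IsCadlag f) (t : ι) (l : E) :
    Tendsto (fun u => ‖f u - l‖) (𝓝[≥] t) (𝓝 ‖f t - l‖) :=
  ((hf t).1.tendsto.sub_const l).norm

variable [OrderTopology ι] [DenselyOrdered ι]

theorem nhdsLT_neBot_of_not_isBot (ht : ¬ IsBot t) : (𝓝[<] t).NeBot := by
  simp only [IsBot, not_forall, not_le] at ht
  exact nhdsLT_neBot_of_exists_lt ht

theorem IsCadlag.tendsto_leftLim (hf : IsCadlag f) (ht : ¬ IsBot t) :
    Tendsto f (𝓝[<] t) (𝓝 (Function.leftLim f t)) := by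
  have := nhdsLT_neBot_of_not_isBot ht
  obtain ⟨l, hl⟩ := (hf t).2
  rwa [leftLim_eq_of_tendsto hl]

theorem IsCadlag.exists_mem_dense_lt_norm_sub (hf : IsCadlag f) {D : Set ι} (hD : Dense D) {l : E}
    {a : ℝ} (ha : a < ‖f s - l‖) (hst : s < t) :
    ∃ q ∈ D, s ≤ q ∧ q < t ∧ a < ‖f q - l‖ := by
  obtain ⟨w, hw, hw_sub⟩ := (mem_nhdsGE_iff_exists_Ico_subset' hst).1
    ((hf.tendsto_norm_sub s l).eventually_const_lt ha)
  obtain ⟨q, hqD, hsq, hq⟩ := hD.exists_between (lt_min hw hst)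
  exact ⟨q, hqD, hsq.le, hq.trans_le (min_le_right _ _),
    hw_sub ⟨hsq.le, hq.trans_le (min_le_left _ _)⟩⟩

theorem IsCadlag.exists_first_exit [CompactSpace ι] (hf : IsCadlag f) (hst : s ≤ t) {a : ℝ}
    (ha : 0 ≤ a) {D : Set ι} (hD : Dense D) :
    ∃ τ ∈ Icc s t,
      (∀ i ≤ t, τ < i ↔ ∃ q ∈ D, s ≤ q ∧ q < i ∧ a < ‖f q - Function.leftLim f s‖) ∧
      ‖Function.leftLim f τ - Function.leftLim f s‖ ≤ a ∧
      (τ < t → a ≤ ‖f τ - Function.leftLim f s‖) := by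
  set l := Function.leftLim f s with hl
  let S : Set ι := {u | s ≤ u ∧ (a < ‖f u - l‖ ∨ u = t)}
  have htS : t ∈ S := ⟨hst, Or.inr rfl⟩
  obtain ⟨τ, -, hτ_closure⟩ : ∃ τ ∈ closure S, IsGLB (closure S) τ :=
    (isClosed_closure (s := S)).isCompact.exists_isGLB ⟨t, subset_closure htS⟩
  have hτ : IsGLB S τ := ⟨fun u hu => hτ_closure.1 (subset_closure hu), fun b hb =>
    hτ_closure.2 fun u hu => closure_minimal (t := Ici b) hb isClosed_Ici hu⟩
  have hsτ : s ≤ τ := hτ.2 fun u hu => hu.1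
  have before_exit : ∀ u, s ≤ u → u < τ → ‖f u - l‖ ≤ a := fun u hsu huτ =>
    not_lt.1 fun h => (hτ.1 ⟨hsu, Or.inl h⟩).not_gt huτ
  refine ⟨τ, ⟨hsτ, hτ.1 htS⟩, fun i hit => ⟨fun hτi => ?_, fun ⟨q, _, hsq, hqi, hq⟩ =>
    (hτ.1 ⟨hsq, Or.inl hq⟩).trans_lt hqi⟩, ?_, fun hτt => ?_⟩
  · obtain ⟨v, ⟨hsv, hv⟩, hvi⟩ := (isGLB_lt_iff hτ).1 hτi
    obtain ⟨q, hqD, hvq, hqi, hq⟩ :=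
      hf.exists_mem_dense_lt_norm_sub hD (hv.resolve_right (hvi.trans_le hit).ne) hvi
    exact ⟨q, hqD, hsv.trans hvq, hqi, hq⟩
  · rcases hsτ.eq_or_lt with rfl | hlt
    · simpa [hl] using ha
    have not_bot : ¬ IsBot τ := fun hb => (hb s).not_gt hlt
    have := nhdsLT_neBot_of_not_isBot not_bot
    refine le_of_tendsto ((hf.tendsto_leftLim not_bot).sub_const l).norm ?_
    filter_upwards [Ioo_mem_nhdsLT hlt] with u hu using before_exit u hu.1.le hu.2
  · by_contra! hlt
    obtain ⟨u, ⟨-, hu⟩, hut, hua⟩ := ((hτ.frequently_mem ⟨t, htS⟩).and_eventually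
      (Filter.Eventually.and (mem_nhdsWithin_of_mem_nhds (Iio_mem_nhds hτt))
        ((hf.tendsto_norm_sub τ l).eventually_lt_const hlt))).exists
    exact hu.elim hua.not_gt (ne_of_lt hut)

end Cadlag

section LeftApprox

variable {ι : Type*} [LinearOrder ι] {e : ℕ → ι} {b u w : ι}

/-- The largest element of `{b, e 0, …, e (k - 1)}` lying strictly before `u`, or `b` if there is
none. For `b` the least element and `e` a dense sequence these points increase to `u` as
`k → ∞`, which expresses left limits at a random time as limits of countably-valued samples. -/
def leftApprox (e : ℕ → ι) (b : ι) : ℕ → ι → ι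
  | 0, _ => b
  | k + 1, u => if leftApprox e b k u < e k ∧ e k < u then e k else leftApprox e b k u

theorem leftApprox_self (hb : IsBot b) (k : ℕ) : leftApprox e b k b = b := by
  induction k with
  | zero => rfl
  | succ k ih => rw [leftApprox, if_neg fun h => (hb _).not_gt h.2, ih]

theorem leftApprox_lt (hu : b < u) (k : ℕ) : leftApprox e b k u < u := by
  induction k with
  | zero => exact hu
  | succ k ih => rw [leftApprox]; split_ifs with h; exacts [h.2, ih]

theorem monotone_leftApprox (e : ℕ → ι) (b u : ι) : Monotone fun k => leftApprox e b k u := by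
  refine monotone_nat_of_le_succ fun k => ?_
  rw [leftApprox]
  split_ifs with h
  exacts [h.1.le, le_rfl]

theorem le_leftApprox_succ {k : ℕ} (hu : e k < u) : e k ≤ leftApprox e b (k + 1) u := by
  rw [leftApprox]
  split_ifs with h
  exacts [le_rfl, not_lt.1 fun hlt => h ⟨hlt, hu⟩]

theorem tendsto_leftApprox [TopologicalSpace ι] [OrderTopology ι] [DenselyOrdered ι]
    (he : DenseRange e) (hu : b < u) :
    Tendsto (fun k => leftApprox e b k u) atTop (𝓝[<] u) := by
  refine tendsto_nhdsWithin_iff.2 ⟨tendsto_order.2 ⟨fun w hw => ?_, fun w hw => ?_⟩,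
    Eventually.of_forall (leftApprox_lt hu)⟩
  · obtain ⟨_, ⟨k, rfl⟩, hwk, hku⟩ := he.exists_between hw
    filter_upwards [eventually_ge_atTop (k + 1)] with n hn
    exact hwk.trans_le ((le_leftApprox_succ hku).trans (monotone_leftApprox e b u hn))
  · exact Eventually.of_forall fun k => (leftApprox_lt hu k).trans hw

theorem IsCadlag.tendsto_leftApprox {E : Type*} [TopologicalSpace ι] [OrderTopology ι]
    [DenselyOrdered ι] [NormedAddCommGroup E] {f : ι → E} (hf : IsCadlag f) (hb : IsBot b)
    (he : DenseRange e) (u : ι) :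
    Tendsto (fun k => f (leftApprox e b k u)) atTop (𝓝 (Function.leftLim f u)) := by
  rcases (hb u).eq_or_lt with rfl | hu
  · simp only [leftApprox_self hb, leftLim_eq_of_isBot hb, tendsto_const_nhds]
  · exact (hf.tendsto_leftLim fun h => (h b).not_gt hu).comp (RoughBMO.tendsto_leftApprox he hu)

end LeftApprox

section StoppingTimes

variable {ι Ω E : Type*} [LinearOrder ι] {mΩ : MeasurableSpace Ω} {𝓕 : Filtration ι mΩ}
  {V : ι → Ω → E} {σ : Ω → ι} {b : ι}

theorem measurableSet_inter_lt_stoppingTime (hσ : IsStoppingTime 𝓕 fun ω => (σ ω : WithTop ι))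
    {q : ι} {A : Set Ω} (hA : MeasurableSet[𝓕 q] A) :
    MeasurableSet[hσ.measurableSpace] (A ∩ {ω | q < σ ω}) := by
  have hlt : {ω | q < σ ω} = {ω | (σ ω : WithTop ι) ≤ q}ᶜ := by ext; simp
  refine ⟨le_iSup (fun i => 𝓕 i) q _ (hA.inter (hlt ▸ (hσ q).compl)), fun i => ?_⟩
  rcases le_or_gt q i with h | h
  · exact ((𝓕.mono h _ hA).inter (𝓕.mono h _ (hlt ▸ (hσ q).compl))).inter (hσ i)
  · convert @MeasurableSet.empty _ (𝓕 i)
    ext ω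
    simp only [mem_inter_iff, mem_ofPred_eq, WithTop.coe_le_coe, mem_empty_iff_false, iff_false]
    grind

theorem measurableSet_lt_stoppingTime (hσ : IsStoppingTime 𝓕 fun ω => (σ ω : WithTop ι)) (q : ι) :
    MeasurableSet[hσ.measurableSpace] {ω | q < σ ω} := by
  simpa using measurableSet_inter_lt_stoppingTime hσ (@MeasurableSet.univ _ (𝓕 q))

theorem measurableSet_leftApprox_stoppingTime (hσ : IsStoppingTime 𝓕 fun ω => (σ ω : WithTop ι))
    (e : ℕ → ι) (b : ι) (k : ℕ) (S : Set ι) :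
    MeasurableSet[hσ.measurableSpace] {ω | leftApprox e b k (σ ω) ∈ S} := by
  induction k generalizing S with
  | zero => exact MeasurableSet.const (b ∈ S)
  | succ k ih =>
    have hset : {ω | leftApprox e b (k + 1) (σ ω) ∈ S} =
        ({ω | leftApprox e b k (σ ω) ∈ Iio (e k)} ∩ {ω | e k < σ ω}).ite {_ω | e k ∈ S}
          {ω | leftApprox e b k (σ ω) ∈ S} := by
      ext ω
      simp only [leftApprox, Set.ite, mem_ofPred_eq, mem_union, mem_inter_iff, Set.mem_sdiff,
        mem_Iio]
      split_ifs with h <;> simp [h]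
    rw [hset]
    exact ((ih _).inter (measurableSet_lt_stoppingTime hσ _)).ite (MeasurableSet.const _) (ih S)

theorem stronglyMeasurable_leftApprox_stoppingTime [NormedAddCommGroup E]
    (hV : StronglyAdapted 𝓕 V) (hσ : IsStoppingTime 𝓕 fun ω => (σ ω : WithTop ι)) (hb : IsBot b)
    (e : ℕ → ι) (k : ℕ) :
    StronglyMeasurable[hσ.measurableSpace] fun ω => V (leftApprox e b k (σ ω)) ω := by
  induction k with
  | zero => exact (hV b).mono (hσ.le_measurableSpace_of_const_le fun ω => by simpa using hb (σ ω))
  | succ k ih =>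
    have sample : StronglyMeasurable[hσ.measurableSpace] ({ω | e k < σ ω}.indicator (V (e k))) := by
      have lt_mem : MeasurableSet[𝓕 (e k)] {ω | e k < σ ω} := by
        simpa only [WithTop.coe_lt_coe] using hσ.measurableSet_gt (e k)
      refine StronglyMeasurable.stronglyMeasurable_of_measurableSpace_le_on lt_mem (fun A hA => ?_)
        ((hV (e k)).indicator lt_mem) fun ω hω => indicator_of_notMem hω _
      have := measurableSet_inter_lt_stoppingTime hσ hA
      rwa [inter_right_comm, inter_self] at this
    have cases_succ : (fun ω => V (leftApprox e b (k + 1) (σ ω)) ω) = fun ω =>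
        if leftApprox e b k (σ ω) < e k ∧ e k < σ ω then {ω | e k < σ ω}.indicator (V (e k)) ω
        else V (leftApprox e b k (σ ω)) ω := by
      ext ω
      rw [leftApprox]
      split_ifs with h
      exacts [(indicator_of_mem (s := {ω | e k < σ ω}) h.2 _).symm, rfl]
    rw [cases_succ]
    exact sample.ite ((measurableSet_leftApprox_stoppingTime hσ e b k (Iio (e k))).inter
      (measurableSet_lt_stoppingTime hσ (e k))) ih

theorem stronglyMeasurable_indicator_le_stoppingTime [NormedAddCommGroup E] {L : Ω → E}
    (hσ : IsStoppingTime 𝓕 fun ω => (σ ω : WithTop ι))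
    (hL : StronglyMeasurable[hσ.measurableSpace] L) (q : ι) :
    StronglyMeasurable[𝓕 q] ({ω | σ ω ≤ q}.indicator L) := by
  have le_mem : MeasurableSet[hσ.measurableSpace] {ω | σ ω ≤ q} := by
    simpa only [WithTop.coe_le_coe] using hσ.measurableSet_le' q
  refine StronglyMeasurable.stronglyMeasurable_of_measurableSpace_le_on le_mem (fun A hA => ?_)
    (hL.indicator le_mem) fun ω hω => indicator_of_notMem hω _
  simpa only [WithTop.coe_le_coe, inter_right_comm _ A, inter_self] using hA.2 q

variable [TopologicalSpace ι] [OrderTopology ι] [DenselyOrdered ι] [SecondCountableTopology ι]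

theorem stronglyMeasurable_leftLim_stoppingTime [NormedAddCommGroup E]
    (hV : StronglyAdapted 𝓕 V) (hc : ∀ ω, IsCadlag fun u => V u ω)
    (hσ : IsStoppingTime 𝓕 fun ω => (σ ω : WithTop ι)) (hb : IsBot b) :
    StronglyMeasurable[hσ.measurableSpace]
      fun ω => Function.leftLim (fun u => V u ω) (σ ω) := by
  have : Nonempty ι := ⟨b⟩
  exact stronglyMeasurable_of_tendsto atTop
    (stronglyMeasurable_leftApprox_stoppingTime hV hσ hb (TopologicalSpace.denseSeq ι))
    (tendsto_pi_nhds.2 fun ω =>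
      (hc ω).tendsto_leftApprox hb (TopologicalSpace.denseRange_denseSeq ι) (σ ω))

theorem isStoppingTime_of_lt (h𝓕 : 𝓕.IsRightContinuous)
    (hσ : ∀ i, MeasurableSet[𝓕 i] {ω | σ ω < i}) :
    IsStoppingTime 𝓕 fun ω => (σ ω : WithTop ι) := by
  intro i
  simp only [WithTop.coe_le_coe]
  by_cases hi : IsMax i
  · simpa only [hi.isTop (σ _)] using MeasurableSet.const _
  rw [← Filtration.IsRightContinuous.eq (𝓕 := 𝓕), Filtration.rightCont_eq_of_not_isMax _ hi]
  simp only [MeasurableSpace.measurableSet_iInf]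
  intro j hij
  obtain ⟨x, -, hx, hx_lim⟩ := exists_seq_strictAnti_tendsto' hij
  have le_eq_iInter_lt : {ω | σ ω ≤ i} = ⋂ m, {ω | σ ω < x m} := by
    ext ω
    simp only [mem_ofPred_eq, mem_iInter]
    exact ⟨fun h m => h.trans_lt (hx m).1, fun h => ge_of_tendsto' hx_lim fun m => (h m).le⟩
  rw [le_eq_iInter_lt]
  exact MeasurableSet.iInter fun m => 𝓕.mono (hx m).2.le _ (hσ _)

theorem exists_hittingTime [CompactSpace ι] [NormedAddCommGroup E] (h𝓕 : 𝓕.IsRightContinuous)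
    (hV : StronglyAdapted 𝓕 V) (hc : ∀ ω, IsCadlag fun u => V u ω)
    (hσ : IsStoppingTime 𝓕 fun ω => (σ ω : WithTop ι)) {t : ι} (hσt : ∀ ω, σ ω ≤ t)
    (hb : IsBot b) {a : ℝ} (ha : 0 ≤ a) :
    ∃ τ : Ω → ι, IsStoppingTime 𝓕 (fun ω => (τ ω : WithTop ι)) ∧
      (∀ ω, σ ω ≤ τ ω ∧ τ ω ≤ t) ∧
      (∀ ω, ‖Function.leftLim (fun u => V u ω) (τ ω) -
        Function.leftLim (fun u => V u ω) (σ ω)‖ ≤ a) ∧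
      ∀ ω, τ ω < t → a ≤ ‖V (τ ω) ω - Function.leftLim (fun u => V u ω) (σ ω)‖ := by
  obtain ⟨D, hDc, hD⟩ := TopologicalSpace.exists_countable_dense ι
  choose τ hτ hτ_lt hτ_left hτ_exit using fun ω => (hc ω).exists_first_exit (hσt ω) ha hD
  refine ⟨τ, isStoppingTime_of_lt h𝓕 fun i => ?_, hτ, hτ_left, hτ_exit⟩
  rcases lt_or_ge t i with hti | hit
  · simpa only [fun ω => (hτ ω).2.trans_lt hti] using MeasurableSet.const _
  set L : Ω → E := fun ω => Function.leftLim (fun u => V u ω) (σ ω)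
  have lt_eq_biUnion : {ω | τ ω < i} = ⋃ q ∈ D, ⋃ _ : q < i,
      {ω | σ ω ≤ q} ∩ {ω | a < ‖V q ω - {ω | σ ω ≤ q}.indicator L ω‖} := by
    ext ω
    simp only [mem_ofPred_eq, hτ_lt ω i hit, mem_iUnion, mem_inter_iff, exists_prop]
    refine exists_congr fun q => and_congr_right fun _ => ?_
    rw [and_left_comm]
    refine and_congr_right fun _ => and_congr_right fun hσq => ?_
    rw [indicator_of_mem (s := {ω | σ ω ≤ q}) hσq]
  rw [lt_eq_biUnion]
  refine MeasurableSet.biUnion hDc fun q _ => MeasurableSet.iUnion fun hqi => 𝓕.mono hqi.le _ ?_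
  refine MeasurableSet.inter (by simpa only [WithTop.coe_le_coe] using hσ q) ?_
  exact ((hV q).sub (stronglyMeasurable_indicator_le_stoppingTime hσ
    (stronglyMeasurable_leftLim_stoppingTime hV hc hσ hb) q)).norm.measurable measurableSet_Ioi

end StoppingTimes

section CondLExpIndicator

variable {Ω : Type*} {m m₀ : MeasurableSpace Ω} {P : Measure[m₀] Ω}

theorem condLExp_indicator (hm : m ≤ m₀) [SigmaFinite (P.trim hm)] (f : Ω → ℝ≥0∞) {B : Set Ω}
    (hB : MeasurableSet[m] B) : P⁻[B.indicator f | m] =ᵐ[P] B.indicator P⁻[f | m] := by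
  refine (ae_eq_condLExp hm P _ ((measurable_condLExp m P f).indicator hB) fun A hA => ?_).symm
  rw [setLIntegral_indicator (hm B hB), setLIntegral_indicator (hm B hB),
    setLIntegral_condLExp hm P f (hB.inter hA)]

end CondLExpIndicator

section MeanVariation

variable {ι Ω E : Type*} [LinearOrder ι] {mΩ : MeasurableSpace Ω} {𝓕 : Filtration ι mΩ}
  {P : Measure Ω} [NormedAddCommGroup E] {V : ι → Ω → E} {s t u : ι}

theorem condLExp_le_meanVariation {σ τ : Ω → ι}
    (hσ : IsStoppingTime 𝓕 fun ω => (σ ω : WithTop ι))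
    (hτ : IsStoppingTime 𝓕 fun ω => (τ ω : WithTop ι))
    (hστ : ∀ ω, s ≤ σ ω ∧ σ ω ≤ τ ω ∧ τ ω ≤ t) :
    P⁻[fun ω => ‖V (τ ω) ω - Function.leftLim (fun u => V u ω) (σ ω)‖ₑ | hσ.measurableSpace]
      ≤ᵐ[P] fun _ => meanVariation 𝓕 P V s t := by
  filter_upwards [enorm_ae_le_eLpNormEssSup (P⁻[fun ω =>
    ‖V (τ ω) ω - Function.leftLim (fun u => V u ω) (σ ω)‖ₑ|hσ.measurableSpace]) P] with ω hω
  rw [← eLpNorm_exponent_top] at hω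
  exact hω.trans (le_iSup_of_le σ <| le_iSup_of_le τ <| le_iSup_of_le hσ <| le_iSup_of_le hτ <|
    le_iSup_of_le hστ le_rfl)

variable [TopologicalSpace ι] [OrderTopology ι] [SecondCountableTopology ι]
  [IsFiniteMeasure P]

theorem condLExp_indicator_lt_exitTime_le {τ τ' : Ω → ι}
    (hτ : IsStoppingTime 𝓕 fun ω => (τ ω : WithTop ι))
    (hτ' : IsStoppingTime 𝓕 fun ω => (τ' ω : WithTop ι))
    (hττ' : ∀ ω, s ≤ τ ω ∧ τ ω ≤ τ' ω ∧ τ' ω ≤ t) {a : ℝ} (ha : 0 < a)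
    (h_exit : ∀ ω, τ' ω < t → a ≤ ‖V (τ' ω) ω - Function.leftLim (fun u => V u ω) (τ ω)‖) :
    P⁻[{ω | τ' ω < t}.indicator 1 | hτ.measurableSpace]
      ≤ᵐ[P] (meanVariation 𝓕 P V s t / ENNReal.ofReal a) • {ω | τ ω < t}.indicator 1 := by
  set X : Ω → ℝ≥0∞ := fun ω => ‖V (τ' ω) ω - Function.leftLim (fun u => V u ω) (τ ω)‖ₑ
  have markov : {ω | τ' ω < t}.indicator 1 ≤
      {ω | τ ω < t}.indicator ((ENNReal.ofReal a)⁻¹ • X) := by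
    intro ω
    by_cases hlt : τ' ω < t
    · rw [indicator_of_mem (s := {ω | τ' ω < t}) hlt,
        indicator_of_mem (s := {ω | τ ω < t}) ((hττ' ω).2.1.trans_lt hlt)]
      have a_le : ENNReal.ofReal a ≤ X ω := by
        simpa only [X, ofReal_norm] using ENNReal.ofReal_le_ofReal (h_exit ω hlt)
      calc (1 : ℝ≥0∞) = (ENNReal.ofReal a)⁻¹ * ENNReal.ofReal a :=
            (ENNReal.inv_mul_cancel (by simpa using ha) ENNReal.ofReal_ne_top).symm
        _ ≤ (ENNReal.ofReal a)⁻¹ * X ω := by gcongr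
    · simp only [indicator_of_notMem (s := {ω | τ' ω < t}) hlt, zero_le]
  have τ_lt_meas : MeasurableSet[hτ.measurableSpace] {ω | τ ω < t} := by
    simpa only [WithTop.coe_lt_coe] using hτ.measurableSet_lt' t
  filter_upwards [condLExp_mono (mΩ := hτ.measurableSpace) (Eventually.of_forall markov),
    condLExp_indicator (P := P) hτ.measurableSpace_le ((ENNReal.ofReal a)⁻¹ • X) τ_lt_meas,
    condLExp_smul' (mΩ := hτ.measurableSpace) (P := P) X
      (ENNReal.inv_ne_top.2 (ENNReal.ofReal_pos.2 ha).ne'),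
    condLExp_le_meanVariation (P := P) (V := V) hτ hτ' hττ'] with ω h_markov h_ind h_smul h_le
  refine h_markov.trans ?_
  rw [h_ind, Pi.smul_apply, smul_eq_mul]
  by_cases hlt : τ ω < t
  · rw [indicator_of_mem (s := {ω | τ ω < t}) hlt, indicator_of_mem (s := {ω | τ ω < t}) hlt,
      h_smul, Pi.smul_apply, smul_eq_mul, Pi.one_apply, mul_one, mul_comm, div_eq_mul_inv]
    gcongr
  · simp only [indicator_of_notMem (s := {ω | τ ω < t}) hlt, zero_le]

variable [DenselyOrdered ι]

theorem enorm_sub_leftLim_le_meanVariation (hV : StronglyAdapted 𝓕 V)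
    (hc : ∀ ω, IsCadlag fun u => V u ω) {b : ι} (hb : IsBot b) (hsu : s ≤ u) (hut : u ≤ t) :
    ∀ᵐ ω ∂P, ‖V u ω - Function.leftLim (fun v => V v ω) u‖ₑ ≤ meanVariation 𝓕 P V s t := by
  have hu := isStoppingTime_const 𝓕 u
  have hL := stronglyMeasurable_leftLim_stoppingTime hV hc hu hb
  have jump_meas : Measurable[𝓕 u] fun ω => ‖V u ω - Function.leftLim (fun v => V v ω) u‖ₑ := by
    rw [IsStoppingTime.measurableSpace_const] at hL
    exact ((hV u).sub hL).enorm
  filter_upwards [condLExp_le_meanVariation (P := P) (V := V) hu hu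
    fun _ => ⟨hsu, le_rfl, hut⟩] with ω hω
  rwa [IsStoppingTime.measurableSpace_const, condLExp_eq_self (𝓕.le u) P jump_meas] at hω

variable [CompactSpace ι]

theorem exists_iterated_hittingTime (h𝓕 : 𝓕.IsRightContinuous) (hV : StronglyAdapted 𝓕 V)
    (hc : ∀ ω, IsCadlag fun u => V u ω) {b : ι} (hb : IsBot b) (hst : s ≤ t) {a : ℝ} (ha : 0 < a)
    (n : ℕ) :
    ∃ τ : Ω → ι, IsStoppingTime 𝓕 (fun ω => (τ ω : WithTop ι)) ∧
      (∀ ω, s ≤ τ ω ∧ τ ω ≤ t) ∧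
      (∀ ω, ‖Function.leftLim (fun u => V u ω) (τ ω) - Function.leftLim (fun u => V u ω) s‖
        ≤ n * a) ∧
      P⁻[{ω | τ ω < t}.indicator 1 | 𝓕 s]
        ≤ᵐ[P] fun _ => (meanVariation 𝓕 P V s t / ENNReal.ofReal a) ^ n := by
  induction n with
  | zero =>
    refine ⟨fun _ => s, isStoppingTime_const 𝓕 s, fun _ => ⟨le_rfl, hst⟩, by simp, ?_⟩
    filter_upwards [condLExp_mono (mΩ := 𝓕 s) (P := P) (Eventually.of_forall
      (indicator_le_self {_ω : Ω | s < t} (1 : Ω → ℝ≥0∞)))] with ω hω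
    simpa only [Pi.one_def, condLExp_const (𝓕.le s), pow_zero] using hω
  | succ n ih =>
    obtain ⟨τ, hτ, hτ_mem, hτ_dist, hτ_prob⟩ := ih
    obtain ⟨τ', hτ', hττ', hτ'_dist, hτ'_exit⟩ :=
      exists_hittingTime h𝓕 hV hc hτ (fun ω => (hτ_mem ω).2) hb ha.le
    refine ⟨τ', hτ', fun ω => ⟨(hτ_mem ω).1.trans (hττ' ω).1, (hττ' ω).2⟩, fun ω => ?_, ?_⟩
    · calc _ ≤ _ := norm_sub_le_norm_sub_add_norm_sub _
            (Function.leftLim (fun u => V u ω) (τ ω)) _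
        _ ≤ a + n * a := add_le_add (hτ'_dist ω) (hτ_dist ω)
        _ = _ := by push_cast; ring
    have tower := condLExp_condLExp_of_le (P := P) (f := {ω | τ' ω < t}.indicator 1)
      (hτ.le_measurableSpace_of_const_le fun ω => WithTop.coe_le_coe.2 (hτ_mem ω).1)
      hτ.measurableSpace_le
    have τ_lt_meas : MeasurableSet {ω | τ ω < t} := by
      simpa only [WithTop.coe_lt_coe] using hτ.measurableSpace_le _ (hτ.measurableSet_lt' t)
    filter_upwards [tower, condLExp_mono (mΩ := 𝓕 s) (condLExp_indicator_lt_exitTime_le hτ hτ'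
      (fun ω => ⟨(hτ_mem ω).1, hττ' ω⟩) ha hτ'_exit), hτ_prob,
      condLExp_smul (mΩ := 𝓕 s) (P := P) _ (measurable_one.indicator τ_lt_meas).aemeasurable
        (meanVariation 𝓕 P V s t / ENNReal.ofReal a)]
      with ω h_tower h_step h_ih h_smul
    rw [h_tower, h_smul] at h_step
    refine h_step.trans ?_
    rw [pow_succ']
    exact mul_le_mul_right h_ih _

theorem condLExp_indicator_lt_norm_sub_le (h𝓕 : 𝓕.IsRightContinuous) (hV : StronglyAdapted 𝓕 V)
    (hc : ∀ ω, IsCadlag fun u => V u ω) {b : ι} (hb : IsBot b) (hst : s ≤ t) {a : ℝ} (ha : 0 < a)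
    (hρ : meanVariation 𝓕 P V s t ≤ ENNReal.ofReal a) (n : ℕ) :
    P⁻[{ω | (n + 2) * a < ‖V t ω - V s ω‖}.indicator 1 | 𝓕 s]
      ≤ᵐ[P] fun _ => (meanVariation 𝓕 P V s t / ENNReal.ofReal a) ^ n := by
  obtain ⟨τ, -, hτ_mem, hτ_dist, hτ_prob⟩ :=
    exists_iterated_hittingTime (P := P) h𝓕 hV hc hb hst ha n
  have le_of_enorm_le : ∀ x : E, ‖x‖ₑ ≤ meanVariation 𝓕 P V s t → ‖x‖ ≤ a := fun x hx =>
    (ENNReal.ofReal_le_ofReal_iff ha.le).1 ((ofReal_norm x).trans_le (hx.trans hρ))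
  refine (condLExp_mono ?_).trans hτ_prob
  filter_upwards [enorm_sub_leftLim_le_meanVariation (P := P) hV hc hb le_rfl hst,
    enorm_sub_leftLim_le_meanVariation (P := P) hV hc hb hst le_rfl] with ω jump_s jump_t
  by_cases hτt : τ ω < t
  · rw [indicator_of_mem (s := {ω | τ ω < t}) hτt]
    exact indicator_le_self _ _ ω
  suffices h_le : ‖V t ω - V s ω‖ ≤ (n + 2) * a by
    simp only [indicator_of_notMem (s := {ω | (n + 2) * a < ‖V t ω - V s ω‖}) h_le.not_gt, zero_le]
  have h_dist := hτ_dist ω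
  rw [(hτ_mem ω).2.eq_of_not_lt hτt] at h_dist
  set L : ι → E := Function.leftLim fun u => V u ω
  calc ‖V t ω - V s ω‖ = ‖(V t ω - L t) + (L t - L s) - (V s ω - L s)‖ := by congr 1; abel
    _ ≤ ‖V t ω - L t‖ + ‖L t - L s‖ + ‖V s ω - L s‖ :=
      (norm_sub_le _ _).trans (by gcongr; exact norm_add_le _ _)
    _ ≤ a + n * a + a := by gcongr; exacts [le_of_enorm_le _ jump_t, le_of_enorm_le _ jump_s]
    _ = (n + 2) * a := by ring

end MeanVariation

section JohnNirenberg

/-- The bound for conditional exponential moments in the John–Nirenberg inequality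
`condLExp_expIncrement_le_johnNirenbergConst`. -/
def johnNirenbergConst : ℝ≥0∞ :=
  ENNReal.ofReal (Real.exp 2) +
    ENNReal.ofReal (Real.exp 3) * (1 - ENNReal.ofReal (Real.exp (-1)))⁻¹

theorem johnNirenbergConst_ne_top : johnNirenbergConst ≠ ∞ := by
  have : ENNReal.ofReal (Real.exp (-1)) < 1 := by simp
  exact ENNReal.add_ne_top.2 ⟨ENNReal.ofReal_ne_top, ENNReal.mul_ne_top ENNReal.ofReal_ne_top
    (ENNReal.inv_ne_top.2 (tsub_pos_of_lt this).ne')⟩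

theorem one_le_johnNirenbergConst : 1 ≤ johnNirenbergConst :=
  (ENNReal.one_le_ofReal.2 (Real.one_le_exp zero_le_two)).trans le_self_add

/-- The exponential `exp (l ‖V_t - V_s‖)` of the size of an increment of `V`, with values in
`[0,∞]`. -/
def expIncrement {ι Ω E : Type*} [NormedAddCommGroup E] (l : ℝ) (V : ι → Ω → E) (s t : ι) (ω : Ω) :
    ℝ≥0∞ :=
  ENNReal.ofReal (Real.exp (l * ‖V t ω - V s ω‖))

theorem ofReal_exp_le_add_tsum_indicator (x : ℝ) :
    ENNReal.ofReal (Real.exp x) ≤ ENNReal.ofReal (Real.exp 2) + ∑' n : ℕ,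
      ENNReal.ofReal (Real.exp (n + 3)) * (Ioi (n + 2 : ℝ)).indicator 1 x := by
  rcases le_or_gt x 2 with hx | hx
  · exact le_add_right (by gcongr)
  have hceil : 2 < ⌈x⌉₊ := Nat.lt_ceil.2 (mod_cast hx)
  obtain ⟨n, hn⟩ : ∃ n, ⌈x⌉₊ = n + 2 + 1 := ⟨⌈x⌉₊ - 3, by omega⟩
  have lt_x : (n + 2 : ℝ) < x := by exact_mod_cast Nat.lt_ceil.1 (show n + 2 < ⌈x⌉₊ by omega)
  have x_le : x ≤ n + 3 := (Nat.le_ceil x).trans_eq (by rw [hn]; push_cast; ring)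
  refine le_add_left (le_trans ?_ (ENNReal.le_tsum n))
  rw [indicator_of_mem (mem_Ioi.2 lt_x), Pi.one_apply, mul_one]
  gcongr

theorem tsum_exp_mul_exp_neg_two_pow :
    ∑' n : ℕ, ENNReal.ofReal (Real.exp (n + 3)) * ENNReal.ofReal (Real.exp (-2)) ^ n =
      ENNReal.ofReal (Real.exp 3) * (1 - ENNReal.ofReal (Real.exp (-1)))⁻¹ := by
  rw [← ENNReal.tsum_geometric, ← ENNReal.tsum_mul_left]
  refine tsum_congr fun n => ?_
  simp only [← ENNReal.ofReal_pow (Real.exp_nonneg _), ← Real.exp_nat_mul,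
    ← ENNReal.ofReal_mul (Real.exp_nonneg _), ← Real.exp_add]
  ring_nf

variable {ι Ω E : Type*} [LinearOrder ι] {mΩ : MeasurableSpace Ω} {𝓕 : Filtration ι mΩ}
  {P : Measure Ω} [NormedAddCommGroup E] {V : ι → Ω → E} {s t : ι}

theorem measurable_norm_sub (hV : StronglyAdapted 𝓕 V) (s t : ι) :
    Measurable fun ω => ‖V t ω - V s ω‖ :=
  (((hV t).mono (𝓕.le t)).sub ((hV s).mono (𝓕.le s))).norm.measurable

theorem measurable_enorm_sub (hV : StronglyAdapted 𝓕 V) (s t : ι) :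
    Measurable fun ω => ‖V t ω - V s ω‖ₑ :=
  (((hV t).mono (𝓕.le t)).sub ((hV s).mono (𝓕.le s))).enorm

variable [TopologicalSpace ι] [OrderTopology ι] [DenselyOrdered ι] [SecondCountableTopology ι]
  [CompactSpace ι] [IsFiniteMeasure P]

theorem condLExp_expIncrement_le_johnNirenbergConst (h𝓕 : 𝓕.IsRightContinuous)
    (hV : StronglyAdapted 𝓕 V) (hc : ∀ ω, IsCadlag fun u => V u ω) {b : ι} (hb : IsBot b)
    (hst : s ≤ t) {l : ℝ} (hl : 0 < l)
    (hρ : meanVariation 𝓕 P V s t * ENNReal.ofReal l ≤ ENNReal.ofReal (Real.exp (-2))) :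
    P⁻[expIncrement l V s t | 𝓕 s]
      ≤ᵐ[P] fun _ => johnNirenbergConst := by
  set tail : ℕ → Ω → ℝ≥0∞ := fun n => {ω | (n + 2) * l⁻¹ < ‖V t ω - V s ω‖}.indicator 1
  have tail_meas : ∀ n, Measurable (tail n) := fun n => measurable_one.indicator
    (measurableSet_lt measurable_const (measurable_norm_sub hV s t))
  have div_eq : ∀ x : ℝ≥0∞, x / ENNReal.ofReal l⁻¹ = x * ENNReal.ofReal l := fun x => by
    rw [ENNReal.ofReal_inv_of_pos hl, div_eq_mul_inv, inv_inv]
  have hρ_le : meanVariation 𝓕 P V s t ≤ ENNReal.ofReal l⁻¹ := by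
    rw [← one_mul (ENNReal.ofReal l⁻¹), ← ENNReal.div_le_iff (by simpa using hl) (by simp), div_eq]
    exact hρ.trans (by simp)
  have exp_le : expIncrement l V s t ≤
      (fun _ => ENNReal.ofReal (Real.exp 2)) +
        ∑' n : ℕ, ENNReal.ofReal (Real.exp (n + 3)) • tail n := fun ω => by
    refine (ofReal_exp_le_add_tsum_indicator _).trans_eq ?_
    simp only [Pi.add_apply, ENNReal.tsum_apply, Pi.smul_apply, smul_eq_mul, tail, indicator_apply,
      mem_Ioi, mem_ofPred_eq, mul_inv_lt_iff₀' hl, Pi.one_apply]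
  filter_upwards [condLExp_mono (mΩ := 𝓕 s) (P := P) (Eventually.of_forall exp_le),
    condLExp_add_left (mΩ := 𝓕 s) (P := P) (X := fun _ => ENNReal.ofReal (Real.exp 2))
      (∑' n : ℕ, ENNReal.ofReal (Real.exp (n + 3)) • tail n) aemeasurable_const,
    condLExp_tsum (𝓕 s) (P := P) fun n =>
      ((tail_meas n).const_smul (ENNReal.ofReal (Real.exp (n + 3)))).aemeasurable,
    ae_all_iff.2 fun n => condLExp_smul (mΩ := 𝓕 s) (P := P) (tail n) (tail_meas n).aemeasurable
      (ENNReal.ofReal (Real.exp (n + 3))),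
    ae_all_iff.2 (condLExp_indicator_lt_norm_sub_le (P := P) h𝓕 hV hc hb hst (inv_pos.2 hl) hρ_le)]
    with ω h_exp h_add h_tsum h_smul h_tail
  rw [h_add, Pi.add_apply, h_tsum, condLExp_const (𝓕.le s), ENNReal.tsum_apply] at h_exp
  refine h_exp.trans ?_
  rw [johnNirenbergConst, ← tsum_exp_mul_exp_neg_two_pow]
  gcongr with n
  rw [h_smul, Pi.smul_apply, smul_eq_mul]
  gcongr
  exact (h_tail n).trans (by rw [div_eq]; gcongr)

theorem ofReal_rpow_le_mul_exp {m : ℝ} (hm : 0 < m) {x : ℝ} (hx : 0 ≤ x) :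
    ENNReal.ofReal x ^ m ≤ ENNReal.ofReal m ^ m * ENNReal.ofReal (Real.exp x) := by
  rw [ENNReal.ofReal_rpow_of_nonneg hx hm.le, ENNReal.ofReal_rpow_of_nonneg hm.le hm.le,
    ← ENNReal.ofReal_mul (by positivity)]
  refine ENNReal.ofReal_le_ofReal ?_
  calc x ^ m = m ^ m * (x / m) ^ m := by
        rw [Real.div_rpow hx hm.le, mul_div_cancel₀ _ (Real.rpow_pos_of_pos hm m).ne']
    _ ≤ m ^ m * Real.exp (x / m) ^ m := by
        gcongr
        linarith [Real.add_one_le_exp (x / m)]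
    _ = m ^ m * Real.exp x := by rw [← Real.exp_mul, div_mul_cancel₀ _ hm.ne']

theorem condLpNorm_enorm_sub_le_of_mul_le (h𝓕 : 𝓕.IsRightContinuous)
    (hV : StronglyAdapted 𝓕 V) (hc : ∀ ω, IsCadlag fun u => V u ω) {b : ι} (hb : IsBot b)
    (hst : s ≤ t) {l : ℝ} (hl : 0 < l)
    (hρ : meanVariation 𝓕 P V s t * ENNReal.ofReal l ≤ ENNReal.ofReal (Real.exp (-2)))
    {m : ℝ} (hm : 0 < m) :
    condLpNorm P m (𝓕 s) (fun ω => ‖V t ω - V s ω‖ₑ)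
      ≤ᵐ[P] fun _ => ENNReal.ofReal (m / l) * johnNirenbergConst ^ (1 / m) := by
  set c : ℝ≥0∞ := ENNReal.ofReal (m / l) ^ m
  have hc_top : c ≠ ∞ := ENNReal.rpow_ne_top_of_nonneg hm.le ENNReal.ofReal_ne_top
  have pow_le : (fun ω => ‖V t ω - V s ω‖ₑ ^ m) ≤
      c • expIncrement l V s t := fun ω => by
    have scale : ‖V t ω - V s ω‖ₑ = ENNReal.ofReal l⁻¹ * ENNReal.ofReal (l * ‖V t ω - V s ω‖) := by
      rw [← ENNReal.ofReal_mul (by positivity), inv_mul_cancel_left₀ hl.ne', ofReal_norm]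
    simp only [Pi.smul_apply, smul_eq_mul, c, div_eq_inv_mul m l,
      ENNReal.ofReal_mul (inv_nonneg.2 hl.le)]
    rw [scale, ENNReal.mul_rpow_of_nonneg _ _ hm.le, ENNReal.mul_rpow_of_nonneg _ _ hm.le,
      mul_assoc]
    gcongr
    exact ofReal_rpow_le_mul_exp hm (by positivity)
  filter_upwards [condLExp_mono (mΩ := 𝓕 s) (P := P) (Eventually.of_forall pow_le),
    condLExp_smul' (mΩ := 𝓕 s) (P := P) (expIncrement l V s t) hc_top,
    condLExp_expIncrement_le_johnNirenbergConst (P := P) h𝓕 hV hc hb hst hl hρ]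
    with ω h_pow h_smul h_exp
  rw [condLpNorm, ← ENNReal.rpow_le_rpow_iff hm, ENNReal.mul_rpow_of_nonneg _ _ hm.le,
    one_div, ENNReal.rpow_inv_rpow hm.ne', ENNReal.rpow_inv_rpow hm.ne']
  refine h_pow.trans ?_
  rw [h_smul, Pi.smul_apply, smul_eq_mul]
  gcongr

/-- The constant comparing conditional moments of order `m` of the increments of a process to its
mean variation in `condLpNorm_enorm_sub_le`. -/
def momentConst (m : ℝ) : ℝ≥0∞ :=
  ENNReal.ofReal (m * Real.exp 2) * johnNirenbergConst ^ (1 / m)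

theorem momentConst_ne_top {m : ℝ} (hm : 0 ≤ m) : momentConst m ≠ ∞ :=
  ENNReal.mul_ne_top ENNReal.ofReal_ne_top
    (ENNReal.rpow_ne_top_of_nonneg (one_div_nonneg.2 hm) johnNirenbergConst_ne_top)

theorem condLpNorm_enorm_sub_le (h𝓕 : 𝓕.IsRightContinuous) (hV : StronglyAdapted 𝓕 V)
    (hc : ∀ ω, IsCadlag fun u => V u ω) {b : ι} (hb : IsBot b) (hst : s ≤ t)
    (hρ : meanVariation 𝓕 P V s t ≠ ∞) {m : ℝ} (hm : 0 < m) :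
    condLpNorm P m (𝓕 s) (fun ω => ‖V t ω - V s ω‖ₑ)
      ≤ᵐ[P] fun _ => momentConst m * meanVariation 𝓕 P V s t := by
  obtain ⟨ρ, hρ_eq⟩ : ∃ ρ : ℝ≥0, (ρ : ℝ≥0∞) = meanVariation 𝓕 P V s t :=
    ⟨_, ENNReal.coe_toNNReal hρ⟩
  -- The vanishing increment keeps the rate `exp (-2) / ρ` finite when `ρ = 0`.
  let ε : ℕ → ℝ := fun n => ρ + 1 / ((n : ℝ) + 1)
  have hε : ∀ n, 0 < ε n := fun n => by positivity
  have bound : ∀ n, condLpNorm P m (𝓕 s) (fun ω => ‖V t ω - V s ω‖ₑ)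
      ≤ᵐ[P] fun _ => momentConst m * ENNReal.ofReal (ε n) := fun n => by
    have rate_le : meanVariation 𝓕 P V s t * ENNReal.ofReal (Real.exp (-2) / ε n) ≤
        ENNReal.ofReal (Real.exp (-2)) := by
      rw [← hρ_eq, ← ENNReal.ofReal_coe_nnreal, ← ENNReal.ofReal_mul ρ.coe_nonneg]
      refine ENNReal.ofReal_le_ofReal ?_
      rw [← mul_div_assoc, div_le_iff₀ (hε n), mul_comm]
      gcongr
      exact le_add_of_nonneg_right (by positivity)
    filter_upwards [condLpNorm_enorm_sub_le_of_mul_le (P := P) h𝓕 hV hc hb hst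
      (div_pos (Real.exp_pos _) (hε n)) rate_le hm] with ω hω
    refine hω.trans_eq ?_
    rw [momentConst, mul_right_comm, ← ENNReal.ofReal_mul (by positivity), Real.exp_neg]
    congr 2
    field_simp
  have lim : Tendsto (fun n => momentConst m * ENNReal.ofReal (ε n)) atTop
      (𝓝 (momentConst m * meanVariation 𝓕 P V s t)) := by
    rw [← hρ_eq, ← ENNReal.ofReal_coe_nnreal]
    refine ENNReal.Tendsto.const_mul (ENNReal.tendsto_ofReal ?_) (Or.inr (momentConst_ne_top hm.le))
    simpa only [add_zero] using tendsto_one_div_add_atTop_nhds_zero_nat.const_add (ρ : ℝ)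
  filter_upwards [ae_all_iff.2 bound] with ω hω using ge_of_tendsto' lim hω

end JohnNirenberg

section Partitions

variable {ι : Type*} [LinearOrder ι] {p : ℝ} {w : ι → ι → ℝ≥0∞} {s t u v : ι}

theorem pVariation_le_iff (hp : 0 < p) {c : ℝ≥0∞} :
    pVariation p w s t ≤ c ↔ ∀ (n : ℕ) (x : Fin (n + 1) → ι), StrictMono x → x 0 = s →
      x (Fin.last n) = t → ∑ i : Fin n, w (x i.castSucc) (x i.succ) ^ p ≤ c ^ p := by
  rw [pVariation, one_div, ENNReal.rpow_inv_le_iff hp]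
  simp only [iSup_le_iff]

theorem sum_rpow_le_pVariation_rpow (hp : 0 < p) {n : ℕ} {x : Fin (n + 1) → ι} (hx : StrictMono x) :
    ∑ i : Fin n, w (x i.castSucc) (x i.succ) ^ p ≤ pVariation p w (x 0) (x (Fin.last n)) ^ p :=
  (pVariation_le_iff hp).1 le_rfl n x hx rfl rfl

theorem rpow_add_sum_rpow_le_pVariation_rpow (hp : 0 < p) {n : ℕ} {x : Fin (n + 1) → ι}
    (hx : StrictMono x) (hu : u < x 0) :
    w u (x 0) ^ p + ∑ i : Fin n, w (x i.castSucc) (x i.succ) ^ p ≤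
      pVariation p w u (x (Fin.last n)) ^ p := by
  have cons_strictMono : StrictMono (Fin.cons u x : Fin (n + 2) → ι) := by
    refine Fin.strictMono_iff_lt_succ.2 fun i => ?_
    refine Fin.cases (by simpa using hu) (fun j => ?_) i
    simpa only [← Fin.succ_castSucc, Fin.cons_succ] using hx j.castSucc_lt_succ
  have := sum_rpow_le_pVariation_rpow (w := w) hp cons_strictMono
  rw [Fin.sum_univ_succ, ← Fin.succ_last] at this
  simpa [← Fin.succ_castSucc] using this

theorem le_pVariation (hp : 0 < p) (hst : s < t) : w s t ≤ pVariation p w s t := by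
  rw [← ENNReal.rpow_le_rpow_iff hp]
  exact le_self_add.trans (rpow_add_sum_rpow_le_pVariation_rpow hp (n := 0) (x := fun _ => t)
    (Fin.strictMono_iff_lt_succ.2 Fin.elim0) hst)

theorem rpow_add_pVariation_rpow_le (hp : 0 < p) (huv : u < v) (hvt : v ≤ t) :
    w u v ^ p + pVariation p w v t ^ p ≤ pVariation p w u t ^ p := by
  have extend : ∀ {n : ℕ} {x : Fin (n + 1) → ι}, StrictMono x → x 0 = v → x (Fin.last n) = t →
      w u v ^ p + ∑ i : Fin n, w (x i.castSucc) (x i.succ) ^ p ≤ pVariation p w u t ^ p := by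
    rintro n x hx rfl rfl
    exact rpow_add_sum_rpow_le_pVariation_rpow hp hx huv
  have first_le : w u v ^ p ≤ pVariation p w u t ^ p := by
    rcases hvt.eq_or_lt with rfl | hvt
    · exact ENNReal.rpow_le_rpow (le_pVariation hp huv) hp.le
    · refine le_self_add.trans (extend (n := 1) (x := ![v, t]) ?_ rfl rfl)
      simpa [Fin.strictMono_iff_lt_succ] using hvt
  rcases eq_or_ne (w u v ^ p) ∞ with h_top | h_top
  · rwa [h_top, top_add, ← h_top]
  refine add_le_of_le_tsub_left_of_le first_le ?_
  rw [← ENNReal.le_rpow_inv_iff hp, pVariation_le_iff hp]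
  intro n x hx h0 hn
  rw [ENNReal.rpow_inv_rpow hp.ne']
  exact ENNReal.le_sub_of_add_le_left h_top (extend hx h0 hn)

theorem pVariation_le_pVariation_of_le (hp : 0 < p) (huv : u ≤ v) (hvt : v ≤ t) :
    pVariation p w v t ≤ pVariation p w u t := by
  rcases huv.eq_or_lt with rfl | huv
  · rfl
  · rw [← ENNReal.rpow_le_rpow_iff hp]
    exact le_add_self.trans (rpow_add_pVariation_rpow_le hp huv hvt)

theorem le_pVariation_of_mem (hp : 0 < p) (hsu : s ≤ u) (huv : u < v) (hvt : v ≤ t) :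
    w u v ≤ pVariation p w s t := by
  rw [← ENNReal.rpow_le_rpow_iff hp]
  exact (le_self_add.trans (rpow_add_pVariation_rpow_le hp huv hvt)).trans
    (ENNReal.rpow_le_rpow (pVariation_le_pVariation_of_le hp hsu (huv.le.trans hvt)) hp.le)

theorem pVariation_mono (hp : 0 < p) {w' : ι → ι → ℝ≥0∞}
    (h : ∀ u v, s ≤ u → u < v → v ≤ t → w u v ≤ w' u v) :
    pVariation p w s t ≤ pVariation p w' s t := by
  refine (pVariation_le_iff hp).2 ?_
  rintro n x hx rfl rfl
  refine le_trans ?_ (sum_rpow_le_pVariation_rpow hp hx)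
  gcongr with i
  exact h _ _ (hx.monotone (Fin.zero_le _)) (hx i.castSucc_lt_succ) (hx.monotone (Fin.le_last _))

theorem pVariation_const_mul_le (hp : 0 < p) (C : ℝ≥0∞) :
    pVariation p (fun u v => C * w u v) s t ≤ C * pVariation p w s t := by
  refine (pVariation_le_iff hp).2 ?_
  rintro n x hx rfl rfl
  simp only [ENNReal.mul_rpow_of_nonneg _ _ hp.le, ← Finset.mul_sum]
  gcongr
  exact sum_rpow_le_pVariation_rpow hp hx

theorem pVariation_add_le (hp : 1 ≤ p) (w w' : ι → ι → ℝ≥0∞) (s t : ι) :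
    pVariation p (fun u v => w u v + w' u v) s t ≤ pVariation p w s t + pVariation p w' s t := by
  have hp₀ : 0 < p := one_pos.trans_le hp
  refine (pVariation_le_iff hp₀).2 ?_
  rintro n x hx rfl rfl
  rw [← ENNReal.rpow_inv_le_iff hp₀, ← one_div]
  refine (ENNReal.Lp_add_le _ _ _ hp).trans (add_le_add ?_ ?_) <;>
  · rw [one_div, ENNReal.rpow_inv_le_iff hp₀]
    exact sum_rpow_le_pVariation_rpow hp₀ hx

theorem pVariation_le_mul_add_mul_of_le (hp : 1 ≤ p) {w₁ w₂ : ι → ι → ℝ≥0∞} {A B : ℝ≥0∞}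
    (h : ∀ u v, s ≤ u → u < v → v ≤ t → w u v ≤ A * (w₁ u v + B * w₂ u v)) :
    pVariation p w s t ≤ A * (pVariation p w₁ s t + B * pVariation p w₂ s t) := by
  have hp₀ : 0 < p := one_pos.trans_le hp
  calc pVariation p w s t
      ≤ pVariation p (fun u v => A * (w₁ u v + B * w₂ u v)) s t := pVariation_mono hp₀ h
    _ ≤ A * pVariation p (fun u v => w₁ u v + B * w₂ u v) s t := pVariation_const_mul_le hp₀ A
    _ ≤ A * (pVariation p w₁ s t + pVariation p (fun u v => B * w₂ u v) s t) :=
        mul_le_mul_right (pVariation_add_le hp w₁ _ s t) A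
    _ ≤ A * (pVariation p w₁ s t + B * pVariation p w₂ s t) :=
        mul_le_mul_right (add_le_add le_rfl (pVariation_const_mul_le hp₀ B)) A

end Partitions

section LongIntervals

variable {ι Ω E : Type*} {mΩ : MeasurableSpace Ω} [NormedAddCommGroup E] {V : ι → Ω → E}

theorem continuous_ofReal_exp_mul_norm (l : ℝ) :
    Continuous fun x : E => ENNReal.ofReal (Real.exp (l * ‖x‖)) :=
  ENNReal.continuous_ofReal.comp (Real.continuous_exp.comp (continuous_norm.const_mul l))

theorem expIncrement_self (l : ℝ) (V : ι → Ω → E) (u : ι) : expIncrement l V u u = fun _ => 1 := by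
  ext; simp [expIncrement]

theorem ofReal_exp_mul_norm_add_le {l : ℝ} (hl : 0 ≤ l) (x y : E) :
    ENNReal.ofReal (Real.exp (l * ‖x + y‖)) ≤
      ENNReal.ofReal (Real.exp (l * ‖x‖)) * ENNReal.ofReal (Real.exp (l * ‖y‖)) := by
  rw [← ENNReal.ofReal_mul (Real.exp_pos _).le, ← Real.exp_add, ← mul_add]
  gcongr
  exact norm_add_le x y

theorem expIncrement_rpow (l m : ℝ) (V : ι → Ω → E) (s t : ι) (ω : Ω) :
    expIncrement l V s t ω ^ m = expIncrement (l * m) V s t ω := by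
  rw [expIncrement, expIncrement, ENNReal.ofReal_rpow_of_pos (Real.exp_pos _), ← Real.exp_mul]
  ring_nf

variable [LinearOrder ι] {𝓕 : Filtration ι mΩ} {P : Measure Ω} {s t u v : ι} {l : ℝ}

theorem measurable_expIncrement (hV : StronglyAdapted 𝓕 V) (l : ℝ) {s t u : ι} (hs : s ≤ u)
    (ht : t ≤ u) : Measurable[𝓕 u] (expIncrement l V s t) :=
  ((continuous_ofReal_exp_mul_norm l).comp_stronglyMeasurable
    (((hV t).mono (𝓕.mono ht)).sub ((hV s).mono (𝓕.mono hs)))).measurable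

variable [IsFiniteMeasure P]

theorem condLExp_expIncrement_le_mul (hV : StronglyAdapted 𝓕 V) (hl : 0 ≤ l) (hsu : s ≤ u)
    {c c' : ℝ≥0∞} (hsu_le : P⁻[expIncrement l V s u | 𝓕 s] ≤ᵐ[P] fun _ => c)
    (hut_le : P⁻[expIncrement l V u t | 𝓕 u] ≤ᵐ[P] fun _ => c') :
    P⁻[expIncrement l V s t | 𝓕 s] ≤ᵐ[P] fun _ => c * c' := by
  have mul_meas : ∀ {a b : ι}, AEMeasurable (expIncrement l V a b) P := fun {a b} =>
    ((measurable_expIncrement hV l (le_max_left a b) (le_max_right a b)).mono (𝓕.le _)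
      le_rfl).aemeasurable
  have split : expIncrement l V s t ≤ expIncrement l V s u * expIncrement l V u t := fun ω => by
    simpa only [expIncrement, add_comm, sub_add_sub_cancel, mul_comm, Pi.mul_apply] using
      ofReal_exp_mul_norm_add_le hl (V t ω - V u ω) (V u ω - V s ω)
  have inner : P⁻[expIncrement l V s u * expIncrement l V u t | 𝓕 u] ≤ᵐ[P]
      fun ω => c' * expIncrement l V s u ω := by
    filter_upwards [condLExp_mul_of_measurable_left (P := P)
      (measurable_expIncrement hV l hsu le_rfl) (mul_meas (a := u) (b := t)), hut_le] with ω h hω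
    rw [h, Pi.mul_apply, mul_comm]
    gcongr
  calc P⁻[expIncrement l V s t | 𝓕 s]
      ≤ᵐ[P] P⁻[expIncrement l V s u * expIncrement l V u t | 𝓕 s] :=
        condLExp_mono (Eventually.of_forall split)
    _ ≤ᵐ[P] P⁻[c' • expIncrement l V s u | 𝓕 s] :=
        condLExp_le_condLExp_of_condLExp_le (𝓕.mono hsu) (𝓕.le u) inner
    _ =ᵐ[P] c' • P⁻[expIncrement l V s u | 𝓕 s] := condLExp_smul _ mul_meas c'
    _ ≤ᵐ[P] fun _ => c * c' := by
        filter_upwards [hsu_le] with ω hω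
        rw [Pi.smul_apply, smul_eq_mul, mul_comm]
        gcongr

theorem condLExp_expIncrement_self_le (l : ℝ) (V : ι → Ω → E) (u : ι) {c : ℝ≥0∞} (hc : 1 ≤ c) :
    P⁻[expIncrement l V u u | 𝓕 u] ≤ᵐ[P] fun _ => c := by
  rw [expIncrement_self, condLExp_const (𝓕.le u)]
  exact Eventually.of_forall fun _ => hc

variable [TopologicalSpace ι] [OrderTopology ι] [DenselyOrdered ι] [FirstCountableTopology ι]

theorem condLExp_expIncrement_le_of_forall_gt (hV : StronglyAdapted 𝓕 V)
    (hc : ∀ ω, IsCadlag fun u => V u ω) (hst : s < t) {c : ℝ≥0∞}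
    (h : ∀ w, s < w → w < t → P⁻[expIncrement l V w t | 𝓕 w] ≤ᵐ[P] fun _ => c) :
    P⁻[expIncrement l V s t | 𝓕 s] ≤ᵐ[P] fun _ => c := by
  obtain ⟨w, -, hw, hw_lim⟩ := exists_seq_strictAnti_tendsto' hst
  have hw_lim' : Tendsto w atTop (𝓝[≥] s) :=
    tendsto_nhdsWithin_iff.2 ⟨hw_lim, Eventually.of_forall fun n => (hw n).1.le⟩
  refine condLExp_le_of_tendsto (F := fun n => expIncrement l V (w n) t) (𝓕.le s)
    (fun n => (measurable_expIncrement hV l (hw n).2.le le_rfl).mono (𝓕.le t) le_rfl)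
    (Eventually.of_forall fun ω => ?_) measurable_const fun n => ?_
  · exact ((continuous_ofReal_exp_mul_norm l).tendsto _).comp
      (((hc ω s).1.tendsto.comp hw_lim').const_sub _)
  · refine (condLExp_le_condLExp_of_condLExp_le (𝓕.mono (hw n).1.le) (𝓕.le _)
      (h (w n) (hw n).1 (hw n).2)).trans_eq ?_
    rw [condLExp_const (𝓕.le s)]

theorem condLExp_expIncrement_le_of_forall_lt (hV : StronglyAdapted 𝓕 V)
    (hc : ∀ ω, IsCadlag fun u => V u ω) (hl : 0 ≤ l) (hst : s < t) {c J : ℝ≥0∞} (hJ : J ≠ ∞)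
    (jump_le : ∀ᵐ ω ∂P, ENNReal.ofReal
      (Real.exp (l * ‖V t ω - Function.leftLim (fun u => V u ω) t‖)) ≤ J)
    (h : ∀ w, s < w → w < t → P⁻[expIncrement l V s w | 𝓕 s] ≤ᵐ[P] fun _ => c) :
    P⁻[expIncrement l V s t | 𝓕 s] ≤ᵐ[P] fun _ => J * c := by
  obtain ⟨w, -, hw, hw_lim⟩ := exists_seq_strictMono_tendsto' hst
  have hw_lim' : Tendsto w atTop (𝓝[<] t) :=
    tendsto_nhdsWithin_iff.2 ⟨hw_lim, Eventually.of_forall fun n => (hw n).2⟩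
  set before : Ω → ℝ≥0∞ := fun ω =>
    ENNReal.ofReal (Real.exp (l * ‖Function.leftLim (fun u => V u ω) t - V s ω‖))
  have before_le : P⁻[before | 𝓕 s] ≤ᵐ[P] fun _ => c := by
    refine condLExp_le_of_tendsto (F := fun n => expIncrement l V s (w n)) (𝓕.le s)
      (fun n => (measurable_expIncrement hV l (hw n).1.le le_rfl).mono (𝓕.le _) le_rfl)
      (Eventually.of_forall fun ω => ?_) measurable_const fun n => h (w n) (hw n).1 (hw n).2
    exact ((continuous_ofReal_exp_mul_norm l).tendsto _).comp
      ((((hc ω).tendsto_leftLim fun ht => (ht s).not_gt hst).comp hw_lim').sub_const _)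
  have split : expIncrement l V s t ≤ᵐ[P] J • before := by
    filter_upwards [jump_le] with ω hω
    have := ofReal_exp_mul_norm_add_le hl (V t ω - Function.leftLim (fun u => V u ω) t)
      (Function.leftLim (fun u => V u ω) t - V s ω)
    rw [sub_add_sub_cancel] at this
    exact this.trans (by rw [Pi.smul_apply, smul_eq_mul]; gcongr)
  filter_upwards [condLExp_mono (mΩ := 𝓕 s) split, condLExp_smul' (mΩ := 𝓕 s) (P := P) before hJ,
    before_le] with ω h_split h_smul hω
  rw [h_smul, Pi.smul_apply, smul_eq_mul] at h_split
  exact h_split.trans (by gcongr)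

/-- `W` measures the remaining mean variation, and the interval is cut into pieces on which `W`
drops by at most `δ`. A cut point may only be reached from the left, which costs a jump. -/
theorem condLExp_expIncrement_le_of_control [CompactSpace ι] (hV : StronglyAdapted 𝓕 V)
    (hc : ∀ ω, IsCadlag fun u => V u ω) (hl : 0 ≤ l) {c J : ℝ≥0∞} (one_le_c : 1 ≤ c)
    (one_le_J : 1 ≤ J) (hJ : J ≠ ∞)
    (jump_le : ∀ u, ∀ᵐ ω ∂P, ENNReal.ofReal
      (Real.exp (l * ‖V u ω - Function.leftLim (fun u => V u ω) u‖)) ≤ J)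
    {W : ι → ℝ≥0∞} (hW : Antitone W) {δ : ℝ≥0∞} (hδ : δ ≠ ∞)
    (short : ∀ u v, u ≤ v → W u ≤ W v + δ → P⁻[expIncrement l V u v | 𝓕 u] ≤ᵐ[P] fun _ => c)
    (N : ℕ) :
    ∀ u v, u ≤ v → W u ≤ W v + (N + 1) * δ →
      P⁻[expIncrement l V u v | 𝓕 u] ≤ᵐ[P] fun _ => (J * c) ^ N * c := by
  induction N with
  | zero => simpa using short
  | succ N ih =>
    intro u v huv hWuv
    let S : Set ι := {w | u ≤ w ∧ w ≤ v ∧ W u ≤ W w + (N + 1) * δ}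
    have huS : u ∈ S := ⟨le_rfl, huv, le_self_add⟩
    obtain ⟨b, -, hb_closure⟩ : ∃ b ∈ closure S, IsLUB (closure S) b :=
      (isClosed_closure (s := S)).isCompact.exists_isLUB ⟨u, subset_closure huS⟩
    have hb : IsLUB S b := ⟨fun w hw => hb_closure.1 (subset_closure hw), fun d hd =>
      hb_closure.2 fun w hw => closure_minimal (t := Iic d) hd isClosed_Iic hw⟩
    have hub : u ≤ b := hb.1 huS
    have hbv : b ≤ v := hb.2 fun w hw => hw.2.1
    have left_piece : P⁻[expIncrement l V u b | 𝓕 u] ≤ᵐ[P] fun _ => J * ((J * c) ^ N * c) := by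
      rcases hub.eq_or_lt with rfl | hub
      · exact condLExp_expIncrement_self_le l V u
          (one_le_mul one_le_J (one_le_mul (one_le_pow₀ (one_le_mul one_le_J one_le_c)) one_le_c))
      refine condLExp_expIncrement_le_of_forall_lt hV hc hl hub hJ (jump_le b) fun w huw hwb => ?_
      obtain ⟨x, hx, hwx⟩ := (lt_isLUB_iff hb).1 hwb
      exact ih u w huw.le (hx.2.2.trans (by gcongr; exact hW hwx.le))
    have right_piece : P⁻[expIncrement l V b v | 𝓕 b] ≤ᵐ[P] fun _ => c := by
      rcases hbv.eq_or_lt with rfl | hbv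
      · exact condLExp_expIncrement_self_le l V b one_le_c
      refine condLExp_expIncrement_le_of_forall_gt hV hc hbv fun w hbw hwv => ?_
      have hw : W w + (N + 1) * δ < W u := not_le.1 fun h =>
        (hb.1 ⟨hub.trans hbw.le, hwv.le, h⟩).not_gt hbw
      refine short w v hwv.le ((ENNReal.add_le_add_iff_right (a := (N + 1) * δ) ?_).1 ?_)
      · exact ENNReal.mul_ne_top (by finiteness) hδ
      · refine hw.le.trans (hWuv.trans_eq ?_)
        push_cast
        ring
    refine (condLExp_expIncrement_le_mul hV hl hub left_piece right_piece).trans_eq ?_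
    exact Eventually.of_forall fun _ => by ring

end LongIntervals

section BMO

variable {ι Ω E : Type*} [LinearOrder ι] [TopologicalSpace ι] {mΩ : MeasurableSpace Ω}
  {𝓕 : Filtration ι mΩ} {P : Measure Ω} [NormedAddCommGroup E] {V : ι → Ω → E} {s t u v : ι}

/-- The bound in `condLExp_expIncrement_le_bmoExpConst` for exponential moments of order `l` of the
increments of a process whose `BMO^{p-var}` norm is at most `K`. -/
def bmoExpConst (p l : ℝ) (K : ℝ≥0) : ℝ≥0∞ :=
  (ENNReal.ofReal (Real.exp (l * K)) * johnNirenbergConst) ^ ⌈(K * (l * Real.exp 2)) ^ p⌉₊ *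
    johnNirenbergConst

theorem bmoExpConst_ne_top (p l : ℝ) (K : ℝ≥0) : bmoExpConst p l K ≠ ∞ :=
  ENNReal.mul_ne_top (ENNReal.pow_ne_top
    (ENNReal.mul_ne_top ENNReal.ofReal_ne_top johnNirenbergConst_ne_top)) johnNirenbergConst_ne_top

theorem one_le_bmoExpConst (p : ℝ) {l : ℝ} (hl : 0 ≤ l) (K : ℝ≥0) : 1 ≤ bmoExpConst p l K :=
  one_le_mul (one_le_pow₀ (one_le_mul (ENNReal.one_le_ofReal.2 (Real.one_le_exp (by positivity)))
    one_le_johnNirenbergConst)) one_le_johnNirenbergConst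

variable [OrderTopology ι] [DenselyOrdered ι] [SecondCountableTopology ι] [IsFiniteMeasure P]

theorem ofReal_exp_mul_norm_sub_leftLim_le (hV : StronglyAdapted 𝓕 V)
    (hc : ∀ ω, IsCadlag fun u => V u ω) {b : ι} (hb : IsBot b) (hsu : s ≤ u) (hut : u ≤ t) {K : ℝ≥0}
    (hK : meanVariation 𝓕 P V s t ≤ K) {l : ℝ} (hl : 0 ≤ l) :
    ∀ᵐ ω ∂P, ENNReal.ofReal (Real.exp (l * ‖V u ω - Function.leftLim (fun u => V u ω) u‖)) ≤
      ENNReal.ofReal (Real.exp (l * K)) := by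
  filter_upwards [enorm_sub_leftLim_le_meanVariation (P := P) hV hc hb hsu hut] with ω hω
  have norm_le : ‖V u ω - Function.leftLim (fun u => V u ω) u‖ ≤ K := by
    simpa only [enorm_le_coe, ← NNReal.coe_le_coe, coe_nnnorm] using hω.trans hK
  gcongr

variable [CompactSpace ι]

theorem condLExp_expIncrement_le_of_pVariation_le (h𝓕 : 𝓕.IsRightContinuous)
    (hV : StronglyAdapted 𝓕 V) (hc : ∀ ω, IsCadlag fun u => V u ω) {b : ι} (hb : IsBot b) {p : ℝ}
    (hp : 0 < p) {l : ℝ} (hl : 0 < l) (huv : u ≤ v) (hvt : v ≤ t)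
    (hv_top : pVariation p (meanVariation 𝓕 P V) v t ≠ ∞)
    (hle : pVariation p (meanVariation 𝓕 P V) u t ^ p ≤
      pVariation p (meanVariation 𝓕 P V) v t ^ p + ENNReal.ofReal (Real.exp (-2) / l) ^ p) :
    P⁻[expIncrement l V u v | 𝓕 u] ≤ᵐ[P] fun _ => johnNirenbergConst := by
  rcases huv.eq_or_lt with rfl | huv
  · exact condLExp_expIncrement_self_le l V u one_le_johnNirenbergConst
  refine condLExp_expIncrement_le_johnNirenbergConst h𝓕 hV hc hb huv.le hl ?_
  have meanVariation_le : meanVariation 𝓕 P V u v ≤ ENNReal.ofReal (Real.exp (-2) / l) := by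
    rw [← ENNReal.rpow_le_rpow_iff hp, ← ENNReal.add_le_add_iff_left
      (ENNReal.rpow_ne_top_of_nonneg hp.le hv_top), add_comm]
    exact (rpow_add_pVariation_rpow_le hp huv hvt).trans hle
  refine (mul_le_mul_left meanVariation_le _).trans_eq ?_
  rw [← ENNReal.ofReal_mul (by positivity), div_mul_cancel₀ _ hl.ne']

theorem coe_rpow_le_ceil_mul_ofReal_rpow (K : ℝ≥0) {p l : ℝ} (hp : 0 ≤ p) (hl : 0 < l) :
    (K : ℝ≥0∞) ^ p ≤ ⌈(K * (l * Real.exp 2)) ^ p⌉₊ * ENNReal.ofReal (Real.exp (-2) / l) ^ p := by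
  calc (K : ℝ≥0∞) ^ p
      = ENNReal.ofReal (K * (l * Real.exp 2)) ^ p * ENNReal.ofReal (Real.exp (-2) / l) ^ p := by
        rw [← ENNReal.mul_rpow_of_nonneg _ _ hp, ← ENNReal.ofReal_mul (by positivity),
          ← ENNReal.ofReal_coe_nnreal, Real.exp_neg]
        congr 2
        field_simp
    _ ≤ ⌈(K * (l * Real.exp 2)) ^ p⌉₊ * ENNReal.ofReal (Real.exp (-2) / l) ^ p := by
        rw [ENNReal.ofReal_rpow_of_nonneg (by positivity) hp, ← ENNReal.ofReal_natCast]
        gcongr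
        exact Nat.le_ceil _

theorem condLExp_expIncrement_le_bmoExpConst (h𝓕 : 𝓕.IsRightContinuous) (hV : StronglyAdapted 𝓕 V)
    (hc : ∀ ω, IsCadlag fun u => V u ω) (hs : IsBot s) (ht : IsTop t) {p : ℝ} (hp : 0 < p)
    {K : ℝ≥0} (hK : bmoVarNorm 𝓕 P p V s t ≤ K) {l : ℝ} (hl : 0 < l) (huv : u ≤ v) :
    P⁻[expIncrement l V u v | 𝓕 u] ≤ᵐ[P] fun _ => bmoExpConst p l K := by
  rcases huv.eq_or_lt with rfl | huv
  · exact condLExp_expIncrement_self_le l V u (one_le_bmoExpConst p hl.le K)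
  have mono : Antitone fun w => pVariation p (meanVariation 𝓕 P V) w t := fun w w' hww' =>
    pVariation_le_pVariation_of_le hp hww' (ht _)
  have le_K : ∀ w, pVariation p (meanVariation 𝓕 P V) w t ≤ K := fun w => (mono (hs w)).trans hK
  have meanVariation_le : meanVariation 𝓕 P V s t ≤ K :=
    (le_pVariation hp (((hs u).trans_lt huv).trans_le (ht v))).trans hK
  refine condLExp_expIncrement_le_of_control hV hc hl.le one_le_johnNirenbergConst
    (ENNReal.one_le_ofReal.2 (Real.one_le_exp (by positivity))) ENNReal.ofReal_ne_top
    (fun w => ofReal_exp_mul_norm_sub_leftLim_le hV hc hs (hs w) (ht w) meanVariation_le hl.le)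
    (W := fun w => pVariation p (meanVariation 𝓕 P V) w t ^ p)
    (fun w w' hww' => ENNReal.rpow_le_rpow (mono hww') hp.le)
    (ENNReal.rpow_ne_top_of_nonneg hp.le (ENNReal.ofReal_ne_top (r := Real.exp (-2) / l)))
    (fun w w' hww' hle => condLExp_expIncrement_le_of_pVariation_le h𝓕 hV hc hs hp hl hww' (ht w')
      (ne_top_of_le_ne_top ENNReal.coe_ne_top (le_K w')) hle) _ u v huv.le ?_
  calc pVariation p (meanVariation 𝓕 P V) u t ^ p ≤ (K : ℝ≥0∞) ^ p :=
        ENNReal.rpow_le_rpow (le_K u) hp.le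
    _ ≤ ⌈(K * (l * Real.exp 2)) ^ p⌉₊ * ENNReal.ofReal (Real.exp (-2) / l) ^ p :=
        coe_rpow_le_ceil_mul_ofReal_rpow K hp.le hl
    _ ≤ pVariation p (meanVariation 𝓕 P V) v t ^ p +
          (⌈(K * (l * Real.exp 2)) ^ p⌉₊ + 1) * ENNReal.ofReal (Real.exp (-2) / l) ^ p :=
        le_add_left (by gcongr; exact le_self_add)

end BMO

section MemBMOVar

/-- The bound in `MemBMOVar.condLpNorm_expIncrement_le` for the conditional `L^m` norm of
`exp |δV|`, when the `BMO^{p-var}` norm of `V` is at most `K`. -/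
def bmoExpLpConst (p m : ℝ) (K : ℝ≥0) : ℝ≥0∞ :=
  bmoExpConst p m K ^ (1 / m)

theorem bmoExpLpConst_ne_top (p : ℝ) {m : ℝ} (hm : 0 ≤ m) (K : ℝ≥0) : bmoExpLpConst p m K ≠ ∞ :=
  ENNReal.rpow_ne_top_of_nonneg (by positivity) (bmoExpConst_ne_top p m K)

variable {ι Ω E : Type*} [LinearOrder ι] {mΩ : MeasurableSpace Ω} {𝓕 : Filtration ι mΩ}
  {P : Measure Ω} [NormedAddCommGroup E] {V V' : ι → Ω → E} {p : ℝ} {s t u v : ι}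

theorem meanVariation_congr (h : ∀ᵐ ω ∂P, ∀ u, V u ω = V' u ω) :
    meanVariation 𝓕 P V = meanVariation 𝓕 P V' := by
  ext s t
  refine iSup_congr fun σ => iSup_congr fun τ => iSup_congr fun _ => iSup_congr fun _ =>
    iSup_congr fun _ => eLpNorm_congr_ae (condLExp_congr_ae ?_)
  filter_upwards [h] with ω hω
  simp only [hω]

theorem meanVariation_zero (𝓕 : Filtration ι mΩ) (P : Measure Ω) :
    meanVariation 𝓕 P (fun _ _ => (0 : E)) = 0 := by
  have leftLim_zero : ∀ u, Function.leftLim (fun _ : ι => (0 : E)) u = 0 := by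
    let _ : TopologicalSpace ι := Preorder.topology ι
    have : OrderTopology ι := ⟨rfl⟩
    exact fun u => ContinuousWithinAt.leftLim_eq continuousWithinAt_const
  have condLExp_zero_fun : ∀ m, P⁻[fun _ => 0 | m] = 0 := fun _ => condLExp_zero P
  ext s t
  simp [meanVariation, leftLim_zero, condLExp_zero_fun]

theorem bmoVarNorm_zero (𝓕 : Filtration ι mΩ) (P : Measure Ω) (hp : 0 < p) (s t : ι) :
    bmoVarNorm 𝓕 P p (fun _ _ => (0 : E)) s t = 0 := by
  rw [bmoVarNorm, meanVariation_zero, ← le_zero_iff, pVariation_le_iff hp]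
  simp [hp]

variable [TopologicalSpace ι]

theorem memBMOVar_zero (𝓕 : Filtration ι mΩ) (P : Measure Ω) (hp : 0 < p) (s t : ι) :
    MemBMOVar 𝓕 P p (fun _ _ => (0 : E)) s t where
  adapted _ := stronglyMeasurable_zero
  cadlag := Eventually.of_forall fun _ _ => ⟨continuousWithinAt_const, 0, tendsto_const_nhds⟩
  norm_lt_top := by
    rw [bmoVarNorm_zero 𝓕 P hp]
    exact ENNReal.zero_lt_top

theorem exists_cadlag_modification (h𝓕 : UsualConditions 𝓕 P) (hV : StronglyAdapted 𝓕 V)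
    (hc : ∀ᵐ ω ∂P, IsCadlag fun u => V u ω) :
    ∃ V' : ι → Ω → E, StronglyAdapted 𝓕 V' ∧ (∀ ω, IsCadlag fun u => V' u ω) ∧
      ∀ᵐ ω ∂P, ∀ u, V' u ω = V u ω := by
  set G : Set Ω := {ω | IsCadlag fun u => V u ω}
  refine ⟨fun u => G.indicator (V u), fun u => ?_, fun ω => ?_, ?_⟩
  · exact (hV u).indicator (MeasurableSet.of_compl (h𝓕.complete u _ hc))
  · by_cases hω : IsCadlag fun u => V u ω
    · simpa only [indicator_of_mem (s := G) hω] using hω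
    · simp only [indicator_of_notMem (s := G) hω]
      exact fun _ => ⟨continuousWithinAt_const, 0, tendsto_const_nhds⟩
  · filter_upwards [hc] with ω hω u using indicator_of_mem (s := G) hω _

variable [OrderTopology ι] [DenselyOrdered ι] [SecondCountableTopology ι] [CompactSpace ι]
  [IsFiniteMeasure P]

theorem MemBMOVar.condLpNorm_expIncrement_le (hV : MemBMOVar 𝓕 P p V s t)
    (h𝓕 : UsualConditions 𝓕 P) (hs : IsBot s) (ht : IsTop t) (hp : 0 < p) {K : ℝ≥0}
    (hK : bmoVarNorm 𝓕 P p V s t ≤ K) {m : ℝ} (hm : 0 < m) (huv : u ≤ v) :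
    condLpNorm P m (𝓕 u) (expIncrement 1 V u v) ≤ᵐ[P] fun _ => bmoExpLpConst p m K := by
  obtain ⟨V', hV', hc', h_eq⟩ := exists_cadlag_modification h𝓕 hV.adapted hV.cadlag
  rw [bmoVarNorm, ← meanVariation_congr h_eq] at hK
  have exp_eq : (fun ω => expIncrement 1 V u v ω ^ m) =ᵐ[P] expIncrement m V' u v := by
    filter_upwards [h_eq] with ω hω
    rw [expIncrement_rpow, one_mul, expIncrement, expIncrement, hω, hω]
  filter_upwards [condLExp_congr_ae (mΩ := 𝓕 u) exp_eq,
    condLExp_expIncrement_le_bmoExpConst h𝓕.rightCont hV' hc' hs ht hp hK hm huv] with ω h_congr hω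
  rw [condLpNorm, h_congr, bmoExpLpConst]
  gcongr

theorem MemBMOVar.condLpNorm_enorm_sub_le (hV : MemBMOVar 𝓕 P p V s t)
    (h𝓕 : UsualConditions 𝓕 P) (hs : IsBot s) (ht : IsTop t) (hp : 0 < p) {m : ℝ} (hm : 0 < m)
    (huv : u < v) :
    condLpNorm P m (𝓕 u) (fun ω => ‖V v ω - V u ω‖ₑ) ≤ᵐ[P]
      fun _ => momentConst m * meanVariation 𝓕 P V u v := by
  obtain ⟨V', hV', hc', h_eq⟩ := exists_cadlag_modification h𝓕 hV.adapted hV.cadlag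
  have hρ : meanVariation 𝓕 P V' u v ≠ ∞ := by
    rw [meanVariation_congr h_eq]
    exact ne_top_of_le_ne_top hV.norm_lt_top.ne (le_pVariation_of_mem hp (hs u) huv (ht v))
  have incr_eq : (fun ω => ‖V v ω - V u ω‖ₑ) =ᵐ[P] fun ω => ‖V' v ω - V' u ω‖ₑ := by
    filter_upwards [h_eq] with ω hω
    rw [hω, hω]
  rw [← meanVariation_congr h_eq]
  exact (condLpNorm_congr incr_eq).trans_le
    (RoughBMO.condLpNorm_enorm_sub_le h𝓕.rightCont hV' hc' hs huv.le hρ hm)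

end MemBMOVar

section Holder

/-- The exponent `s` with `1 / s + 1 / q = 1 / r`, for `0 < r < q`. -/
def holderComplement (q r : ℝ) : ℝ :=
  (r⁻¹ - q⁻¹)⁻¹

theorem holderTriple_holderComplement {q r : ℝ} (hr : 0 < r) (hrq : r < q) :
    (holderComplement q r).HolderTriple q r where
  inv_add_inv_eq_inv := by rw [holderComplement, inv_inv, sub_add_cancel]
  left_pos := inv_pos.2 (sub_pos.2 (inv_strictAnti₀ hr hrq))
  right_pos := hr.trans hrq

theorem holderTriple_two_mul {m : ℝ} (hm : 0 < m) : (2 * m).HolderTriple (2 * m) m where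
  inv_add_inv_eq_inv := by field_simp; norm_num
  left_pos := by positivity
  right_pos := by positivity

theorem eLpNorm_mul_le_mul_eLpNorm {Ω : Type*} {mΩ : MeasurableSpace Ω} {P : Measure Ω}
    {f g : Ω → ℝ≥0∞} {p q r : ℝ} (hpqr : p.HolderTriple q r) (hf : AEMeasurable f P)
    (hg : AEMeasurable g P) :
    eLpNorm (f * g) (ENNReal.ofReal r) P ≤
      eLpNorm f (ENNReal.ofReal p) P * eLpNorm g (ENNReal.ofReal q) P := by
  have eLpNorm_eq : ∀ {a : ℝ} (_ : 0 < a) (h : Ω → ℝ≥0∞),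
      eLpNorm h (ENNReal.ofReal a) P = (∫⁻ ω, h ω ^ a ∂P) ^ (1 / a) := fun ha h => by
    rw [eLpNorm_eq_lintegral_rpow_enorm_toReal (ENNReal.ofReal_pos.2 ha).ne' ENNReal.ofReal_ne_top,
      ENNReal.toReal_ofReal ha.le]
    simp only [enorm_eq_self]
  rw [eLpNorm_eq hpqr.pos', eLpNorm_eq hpqr.pos, eLpNorm_eq hpqr.symm.pos]
  exact ENNReal.lintegral_Lp_mul_le_Lq_mul_Lr hpqr.pos' hpqr.lt hpqr.one_div_eq P hf hg

end Holder

section Exponential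

theorem abs_exp_sub_exp_le (x y : ℝ) :
    |Real.exp x - Real.exp y| ≤ Real.exp |x| * Real.exp |y| * |x - y| := by
  wlog hxy : y ≤ x generalizing x y
  · rw [abs_sub_comm, abs_sub_comm x, mul_comm (Real.exp _)]
    exact this y x (not_le.1 hxy).le
  rw [abs_of_nonneg (sub_nonneg.2 (Real.exp_le_exp.2 hxy)), abs_of_nonneg (sub_nonneg.2 hxy)]
  calc Real.exp x - Real.exp y = Real.exp x * (1 - Real.exp (y - x)) := by
        rw [mul_sub, mul_one, ← Real.exp_add, add_sub_cancel]
    _ ≤ Real.exp x * (x - y) :=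
        mul_le_mul_of_nonneg_left (by linarith [Real.add_one_le_exp (y - x)]) (Real.exp_pos x).le
    _ ≤ Real.exp |x| * Real.exp |y| * (x - y) := by
        refine mul_le_mul_of_nonneg_right ?_ (sub_nonneg.2 hxy)
        exact (Real.exp_le_exp.2 (le_abs_self x)).trans
          (le_mul_of_one_le_right (by positivity) (Real.one_le_exp (abs_nonneg y)))

theorem abs_exp_add_sub_exp_add_sub_le (a b x y : ℝ) :
    |(Real.exp (a + x) - Real.exp (b + y)) - (Real.exp a - Real.exp b)| ≤
      Real.exp |a| * Real.exp |b| * (Real.exp |x| * Real.exp |y| * |x - y| +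
        |a - b| * (Real.exp |y| * |y|)) := by
  have decomp : (Real.exp (a + x) - Real.exp (b + y)) - (Real.exp a - Real.exp b) =
      Real.exp a * (Real.exp x - Real.exp y) +
        (Real.exp a - Real.exp b) * (Real.exp y - Real.exp 0) := by
    rw [Real.exp_add, Real.exp_add, Real.exp_zero]
    ring
  have exp_a_le : Real.exp a ≤ Real.exp |a| * Real.exp |b| :=
    (Real.exp_le_exp.2 (le_abs_self a)).trans
      (le_mul_of_one_le_right (by positivity) (Real.one_le_exp (abs_nonneg b)))
  have exp_y_le : |Real.exp y - Real.exp 0| ≤ Real.exp |y| * |y| := by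
    simpa using abs_exp_sub_exp_le y 0
  calc |(Real.exp (a + x) - Real.exp (b + y)) - (Real.exp a - Real.exp b)|
      ≤ Real.exp a * |Real.exp x - Real.exp y| +
          |Real.exp a - Real.exp b| * |Real.exp y - Real.exp 0| := by
        rw [decomp]
        refine (abs_add_le _ _).trans_eq ?_
        rw [abs_mul, abs_mul, Real.abs_exp]
    _ ≤ Real.exp |a| * Real.exp |b| * (Real.exp |x| * Real.exp |y| * |x - y|) +
          Real.exp |a| * Real.exp |b| * |a - b| * (Real.exp |y| * |y|) := by
        gcongr
        · exact abs_exp_sub_exp_le x y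
        · exact abs_exp_sub_exp_le a b
    _ = Real.exp |a| * Real.exp |b| * (Real.exp |x| * Real.exp |y| * |x - y| +
          |a - b| * (Real.exp |y| * |y|)) := by ring

end Exponential

section ExpNorm

variable {ι Ω E : Type*} {mΩ : MeasurableSpace Ω} [NormedAddCommGroup E]

/-- The process `exp |V|`, with values in `[0,∞]`. -/
def expNorm (V : ι → Ω → E) (u : ι) (ω : Ω) : ℝ≥0∞ :=
  ENNReal.ofReal (Real.exp ‖V u ω‖)

theorem measurable_expNorm [Preorder ι] {𝓕 : Filtration ι mΩ} {V : ι → Ω → E}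
    (hV : StronglyAdapted 𝓕 V) (u : ι) : Measurable[𝓕 u] (expNorm V u) :=
  (Real.measurable_exp.comp (hV u).norm.measurable).ennreal_ofReal

theorem expNorm_le_mul_expIncrement {P : Measure Ω} {V : ι → Ω → E} {s : ι} {K₀ : ℝ≥0}
    (h₀ : eLpNorm (V s) ∞ P ≤ K₀) (u : ι) :
    expNorm V u ≤ᵐ[P] fun ω => ENNReal.ofReal (Real.exp K₀) * expIncrement 1 V s u ω := by
  rw [eLpNorm_exponent_top] at h₀
  filter_upwards [enorm_ae_le_eLpNormEssSup (V s) P] with ω hω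
  have initial_le : ‖V s ω‖ ≤ K₀ := enorm_le_coe.1 (hω.trans h₀)
  rw [expNorm, expIncrement, ← ENNReal.ofReal_mul (Real.exp_pos _).le, ← Real.exp_add, one_mul]
  gcongr
  linarith [norm_sub_norm_le (V u ω) (V s ω)]

theorem enorm_increment_exp_sub_exp_le (V V' : ι → Ω → ℝ) (u v : ι) (ω : Ω) :
    ‖increment (fun t ω => Real.exp (V t ω) - Real.exp (V' t ω)) u v ω‖ₑ ≤
      expNorm V u ω * expNorm V' u ω *
        (expIncrement 1 V u v ω * expIncrement 1 V' u v ω *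
            ‖increment (fun t ω => V t ω - V' t ω) u v ω‖ₑ +
          ‖V u ω - V' u ω‖ₑ * (expIncrement 1 V' u v ω * ‖V' v ω - V' u ω‖ₑ)) := by
  have h := abs_exp_add_sub_exp_add_sub_le (V u ω) (V' u ω) (V v ω - V u ω) (V' v ω - V' u ω)
  rw [add_sub_cancel, add_sub_cancel,
    sub_sub_sub_comm (V v ω) (V u ω) (V' v ω) (V' u ω)] at h
  simp only [increment, expNorm, expIncrement, one_mul, Real.enorm_eq_ofReal_abs, Real.norm_eq_abs]
  refine (ENNReal.ofReal_le_ofReal h).trans_eq ?_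
  rw [ENNReal.ofReal_mul (by positivity), ENNReal.ofReal_mul (by positivity),
    ENNReal.ofReal_add (by positivity) (by positivity), ENNReal.ofReal_mul (by positivity),
    ENNReal.ofReal_mul (by positivity), ENNReal.ofReal_mul (by positivity),
    ENNReal.ofReal_mul (by positivity)]

end ExpNorm

section WeightedCondLpNorm

variable {Ω : Type*} {m m₀ : MeasurableSpace Ω} {P : Measure[m₀] Ω} {f g ξ X Y : Ω → ℝ≥0∞}
  {a b c p q r : ℝ} {C : ℝ≥0∞}

theorem eLpNorm_condLpNorm_add_le (hm : m ≤ m₀) (hq : 1 ≤ q) (hf : AEMeasurable f P) {e : ℝ≥0∞}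
    (he : 1 ≤ e) :
    eLpNorm (condLpNorm P q m (f + g)) e P ≤
      2 * (eLpNorm (condLpNorm P q m f) e P + eLpNorm (condLpNorm P q m g) e P) := by
  have meas : ∀ h, AEStronglyMeasurable (condLpNorm P q m h) P := fun h =>
    ((measurable_condLpNorm P q m h).mono hm le_rfl).aestronglyMeasurable
  calc eLpNorm (condLpNorm P q m (f + g)) e P
      ≤ 2 * eLpNorm (condLpNorm P q m f + condLpNorm P q m g) e P :=
        eLpNorm_le_mul_eLpNorm_of_ae_le_mul'' e ((meas f).add (meas g)) (condLpNorm_add_le hq hf)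
    _ ≤ 2 * (eLpNorm (condLpNorm P q m f) e P + eLpNorm (condLpNorm P q m g) e P) := by
        gcongr
        exact eLpNorm_add_le (meas f) (meas g) he

theorem eLpNorm_condLpNorm_mul_mul_le (hpqr : p.HolderTriple q r) (habc : a.HolderTriple b c)
    (hm : m ≤ m₀) [SigmaFinite (P.trim hm)] (hξ : Measurable[m] ξ) (hY : AEMeasurable Y P)
    (hX : AEMeasurable X P) (hYC : condLpNorm P p m Y ≤ᵐ[P] fun _ => C) :
    eLpNorm (condLpNorm P r m (ξ * (Y * X))) (ENNReal.ofReal c) P ≤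
      C * (eLpNorm ξ (ENNReal.ofReal a) P *
        eLpNorm (condLpNorm P q m X) (ENNReal.ofReal b) P) := by
  have meas_ξ := hξ.mono hm le_rfl
  have meas_X := (measurable_condLpNorm P q m X).mono hm le_rfl
  have cond_le : condLpNorm P r m (ξ * (Y * X)) ≤ᵐ[P]
      fun ω => C * (ξ * condLpNorm P q m X) ω := by
    filter_upwards [condLpNorm_mul_of_measurable_left hpqr.pos' hξ (hY.mul hX),
      condLpNorm_mul_le hpqr hm hY hX, hYC] with ω h_eq h_le hω
    rw [h_eq, Pi.mul_apply, Pi.mul_apply, mul_left_comm]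
    exact mul_le_mul_right (h_le.trans (mul_le_mul_left hω _)) _
  calc eLpNorm (condLpNorm P r m (ξ * (Y * X))) (ENNReal.ofReal c) P
      ≤ C * eLpNorm (ξ * condLpNorm P q m X) (ENNReal.ofReal c) P :=
        eLpNorm_le_mul_eLpNorm_of_ae_le_mul'' _ (meas_ξ.mul meas_X).aestronglyMeasurable cond_le
    _ ≤ C * (eLpNorm ξ (ENNReal.ofReal a) P *
          eLpNorm (condLpNorm P q m X) (ENNReal.ofReal b) P) := by
        gcongr
        exact eLpNorm_mul_le_mul_eLpNorm habc meas_ξ.aemeasurable meas_X.aemeasurable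

theorem eLpNorm_condLpNorm_mul_mul_le_of_measurable (hq : 0 < q) (habc : a.HolderTriple b c)
    (hm : m ≤ m₀) (hξ : Measurable[m] ξ) (hX : Measurable[m] X) (hY : AEMeasurable Y P)
    (hYC : condLpNorm P q m Y ≤ᵐ[P] fun _ => C) :
    eLpNorm (condLpNorm P q m (ξ * (X * Y))) (ENNReal.ofReal c) P ≤
      C * (eLpNorm ξ (ENNReal.ofReal a) P * eLpNorm X (ENNReal.ofReal b) P) := by
  have meas_ξ := hξ.mono hm le_rfl
  have meas_X := hX.mono hm le_rfl
  have cond_le : condLpNorm P q m (ξ * (X * Y)) ≤ᵐ[P] fun ω => C * (ξ * X) ω := by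
    rw [← mul_assoc]
    filter_upwards [condLpNorm_mul_of_measurable_left hq (hξ.mul hX) hY, hYC] with ω h_eq hω
    rw [h_eq, Pi.mul_apply, mul_comm]
    exact mul_le_mul_left hω _
  calc eLpNorm (condLpNorm P q m (ξ * (X * Y))) (ENNReal.ofReal c) P
      ≤ C * eLpNorm (ξ * X) (ENNReal.ofReal c) P :=
        eLpNorm_le_mul_eLpNorm_of_ae_le_mul'' _ (meas_ξ.mul meas_X).aestronglyMeasurable cond_le
    _ ≤ C * (eLpNorm ξ (ENNReal.ofReal a) P * eLpNorm X (ENNReal.ofReal b) P) := by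
        gcongr
        exact eLpNorm_mul_le_mul_eLpNorm habc meas_ξ.aemeasurable meas_X.aemeasurable

end WeightedCondLpNorm

section ExpMoments

variable {ι Ω E : Type*} [LinearOrder ι] [TopologicalSpace ι] [OrderTopology ι]
  [DenselyOrdered ι] [SecondCountableTopology ι] [CompactSpace ι] {mΩ : MeasurableSpace Ω}
  {𝓕 : Filtration ι mΩ} {P : Measure Ω} [NormedAddCommGroup E] {V V' : ι → Ω → E}
  {p m : ℝ} {s t u v : ι} {K K' K₀ K₀' : ℝ≥0}

theorem MemBMOVar.condLpNorm_expIncrement_mul_expIncrement_le [IsFiniteMeasure P]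
    (hV : MemBMOVar 𝓕 P p V s t) (hV' : MemBMOVar 𝓕 P p V' s t) (h𝓕 : UsualConditions 𝓕 P)
    (hs : IsBot s) (ht : IsTop t) (hp : 0 < p) (hK : bmoVarNorm 𝓕 P p V s t ≤ K)
    (hK' : bmoVarNorm 𝓕 P p V' s t ≤ K') (hm : 0 < m) (huv : u ≤ v) :
    condLpNorm P m (𝓕 u) (expIncrement 1 V u v * expIncrement 1 V' u v) ≤ᵐ[P]
      fun _ => bmoExpLpConst p (2 * m) K * bmoExpLpConst p (2 * m) K' := by
  have h2m : 0 < 2 * m := by positivity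
  have meas : ∀ {U : ι → Ω → E}, MemBMOVar 𝓕 P p U s t →
      AEMeasurable (expIncrement 1 U u v) P := fun hU =>
    ((measurable_expIncrement hU.adapted 1 huv le_rfl).mono (𝓕.le v) le_rfl).aemeasurable
  filter_upwards [condLpNorm_mul_le (holderTriple_two_mul hm) (𝓕.le u) (meas hV) (meas hV'),
    hV.condLpNorm_expIncrement_le h𝓕 hs ht hp hK h2m huv,
    hV'.condLpNorm_expIncrement_le h𝓕 hs ht hp hK' h2m huv] with ω h_mul h_V h_V'
  exact h_mul.trans (mul_le_mul' h_V h_V')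

theorem MemBMOVar.condLpNorm_expIncrement_mul_enorm_sub_le [IsFiniteMeasure P]
    (hV : MemBMOVar 𝓕 P p V s t) (h𝓕 : UsualConditions 𝓕 P) (hs : IsBot s) (ht : IsTop t)
    (hp : 0 < p) (hK : bmoVarNorm 𝓕 P p V s t ≤ K) (hm : 0 < m) (huv : u < v) :
    condLpNorm P m (𝓕 u) (expIncrement 1 V u v * fun ω => ‖V v ω - V u ω‖ₑ) ≤ᵐ[P]
      fun _ => bmoExpLpConst p (2 * m) K * (momentConst (2 * m) * meanVariation 𝓕 P V u v) := by
  have h2m : 0 < 2 * m := by positivity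
  have meas_exp : AEMeasurable (expIncrement 1 V u v) P :=
    ((measurable_expIncrement hV.adapted 1 huv.le le_rfl).mono (𝓕.le v) le_rfl).aemeasurable
  filter_upwards [condLpNorm_mul_le (holderTriple_two_mul hm) (𝓕.le u) meas_exp
      (measurable_enorm_sub hV.adapted u v).aemeasurable,
    hV.condLpNorm_expIncrement_le h𝓕 hs ht hp hK h2m huv.le,
    hV.condLpNorm_enorm_sub_le h𝓕 hs ht hp h2m huv] with ω h_mul h_exp h_sub
  exact h_mul.trans (mul_le_mul' h_exp h_sub)

/-- The bound in `MemBMOVar.eLpNorm_expNorm_le` for the `L^m` norm of `exp |V|`. -/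
def bmoExpNormLpConst (p m : ℝ) (K₀ K : ℝ≥0) : ℝ≥0∞ :=
  ENNReal.ofReal (Real.exp K₀) * bmoExpLpConst p m K

theorem bmoExpNormLpConst_ne_top (p : ℝ) {m : ℝ} (hm : 0 ≤ m) (K₀ K : ℝ≥0) :
    bmoExpNormLpConst p m K₀ K ≠ ∞ :=
  ENNReal.mul_ne_top ENNReal.ofReal_ne_top (bmoExpLpConst_ne_top p hm K)

variable [IsProbabilityMeasure P]

theorem MemBMOVar.eLpNorm_expNorm_le (hV : MemBMOVar 𝓕 P p V s t) (h𝓕 : UsualConditions 𝓕 P)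
    (hs : IsBot s) (ht : IsTop t) (hp : 0 < p) (h₀ : eLpNorm (V s) ∞ P ≤ K₀)
    (hK : bmoVarNorm 𝓕 P p V s t ≤ K) (hm : 0 < m) (u : ι) :
    eLpNorm (expNorm V u) (ENNReal.ofReal m) P ≤ bmoExpNormLpConst p m K₀ K := by
  have meas := ((measurable_expIncrement hV.adapted 1 (hs u) le_rfl).mono (𝓕.le u)
    le_rfl).aestronglyMeasurable (μ := P)
  calc eLpNorm (expNorm V u) (ENNReal.ofReal m) P
      ≤ ENNReal.ofReal (Real.exp K₀) * eLpNorm (expIncrement 1 V s u) (ENNReal.ofReal m) P :=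
        eLpNorm_le_mul_eLpNorm_of_ae_le_mul'' _ meas (expNorm_le_mul_expIncrement h₀ u)
    _ = ENNReal.ofReal (Real.exp K₀) *
          eLpNorm (condLpNorm P m (𝓕 s) (expIncrement 1 V s u)) (ENNReal.ofReal m) P := by
        rw [eLpNorm_condLpNorm (𝓕.le s) hm]
    _ ≤ ENNReal.ofReal (Real.exp K₀) * bmoExpLpConst p m K := by
        gcongr
        exact eLpNorm_le_of_ae_le_const (hV.condLpNorm_expIncrement_le h𝓕 hs ht hp hK hm (hs u))

/-- The bound in `MemBMOVar.eLpNorm_expNorm_mul_expNorm_le` for the `L^m` norm of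
`exp |V| exp |V'|`. -/
def bmoExpNormMulLpConst (p m : ℝ) (K₀ K₀' K K' : ℝ≥0) : ℝ≥0∞ :=
  bmoExpNormLpConst p (2 * m) K₀ K * bmoExpNormLpConst p (2 * m) K₀' K'

theorem bmoExpNormMulLpConst_ne_top (p : ℝ) {m : ℝ} (hm : 0 ≤ m) (K₀ K₀' K K' : ℝ≥0) :
    bmoExpNormMulLpConst p m K₀ K₀' K K' ≠ ∞ :=
  ENNReal.mul_ne_top (bmoExpNormLpConst_ne_top p (by positivity) K₀ K)
    (bmoExpNormLpConst_ne_top p (by positivity) K₀' K')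

theorem MemBMOVar.eLpNorm_expNorm_mul_expNorm_le (hV : MemBMOVar 𝓕 P p V s t)
    (hV' : MemBMOVar 𝓕 P p V' s t) (h𝓕 : UsualConditions 𝓕 P) (hs : IsBot s) (ht : IsTop t)
    (hp : 0 < p) (h₀ : eLpNorm (V s) ∞ P ≤ K₀) (h₀' : eLpNorm (V' s) ∞ P ≤ K₀')
    (hK : bmoVarNorm 𝓕 P p V s t ≤ K) (hK' : bmoVarNorm 𝓕 P p V' s t ≤ K') (hm : 0 < m) (u : ι) :
    eLpNorm (expNorm V u * expNorm V' u) (ENNReal.ofReal m) P ≤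
      bmoExpNormMulLpConst p m K₀ K₀' K K' := by
  have h2m : 0 < 2 * m := by positivity
  have meas : ∀ {U : ι → Ω → E}, MemBMOVar 𝓕 P p U s t → AEMeasurable (expNorm U u) P :=
    fun hU => ((measurable_expNorm hU.adapted u).mono (𝓕.le u) le_rfl).aemeasurable
  exact (eLpNorm_mul_le_mul_eLpNorm (holderTriple_two_mul hm) (meas hV) (meas hV')).trans
    (mul_le_mul' (hV.eLpNorm_expNorm_le h𝓕 hs ht hp h₀ hK h2m u)
      (hV'.eLpNorm_expNorm_le h𝓕 hs ht hp h₀' hK' h2m u))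

theorem MemBMOVar.eLpNorm_condLpNorm_mul_expIncrement_mul_le (hV : MemBMOVar 𝓕 P p V s t)
    (hV' : MemBMOVar 𝓕 P p V' s t) (h𝓕 : UsualConditions 𝓕 P) (hs : IsBot s) (ht : IsTop t)
    (hp : 0 < p) (h₀ : eLpNorm (V s) ∞ P ≤ K₀) (h₀' : eLpNorm (V' s) ∞ P ≤ K₀')
    (hK : bmoVarNorm 𝓕 P p V s t ≤ K) (hK' : bmoVarNorm 𝓕 P p V' s t ≤ K') {a b c l q r : ℝ}
    (hlqr : l.HolderTriple q r) (habc : a.HolderTriple b c) (huv : u ≤ v) {X : Ω → ℝ≥0∞}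
    (hX : AEMeasurable X P) :
    eLpNorm (condLpNorm P r (𝓕 u) (expNorm V u * expNorm V' u *
        (expIncrement 1 V u v * expIncrement 1 V' u v * X))) (ENNReal.ofReal c) P ≤
      bmoExpLpConst p (2 * l) K * bmoExpLpConst p (2 * l) K' *
        (bmoExpNormMulLpConst p a K₀ K₀' K K' *
          eLpNorm (condLpNorm P q (𝓕 u) X) (ENNReal.ofReal b) P) := by
  have meas : ∀ {U : ι → Ω → E}, MemBMOVar 𝓕 P p U s t → Measurable (expIncrement 1 U u v) :=
    fun hU => (measurable_expIncrement hU.adapted 1 huv le_rfl).mono (𝓕.le v) le_rfl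
  refine (eLpNorm_condLpNorm_mul_mul_le hlqr habc (𝓕.le u)
    ((measurable_expNorm hV.adapted u).mul (measurable_expNorm hV'.adapted u))
    ((meas hV).mul (meas hV')).aemeasurable hX
    (hV.condLpNorm_expIncrement_mul_expIncrement_le hV' h𝓕 hs ht hp hK hK' hlqr.pos huv)).trans ?_
  gcongr
  exact hV.eLpNorm_expNorm_mul_expNorm_le hV' h𝓕 hs ht hp h₀ h₀' hK hK' habc.pos u

theorem MemBMOVar.eLpNorm_condLpNorm_mul_mul_enorm_sub_le (hV : MemBMOVar 𝓕 P p V s t)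
    (hV' : MemBMOVar 𝓕 P p V' s t) (h𝓕 : UsualConditions 𝓕 P) (hs : IsBot s) (ht : IsTop t)
    (hp : 0 < p) (h₀ : eLpNorm (V s) ∞ P ≤ K₀) (h₀' : eLpNorm (V' s) ∞ P ≤ K₀')
    (hK : bmoVarNorm 𝓕 P p V s t ≤ K) (hK' : bmoVarNorm 𝓕 P p V' s t ≤ K') {a b c q : ℝ}
    (hq : 0 < q) (habc : a.HolderTriple b c) (huv : u < v) {X : Ω → ℝ≥0∞}
    (hX : Measurable[𝓕 u] X) :
    eLpNorm (condLpNorm P q (𝓕 u) (expNorm V u * expNorm V' u *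
        (X * (expIncrement 1 V' u v * fun ω => ‖V' v ω - V' u ω‖ₑ)))) (ENNReal.ofReal c) P ≤
      bmoExpLpConst p (2 * q) K' * (momentConst (2 * q) * meanVariation 𝓕 P V' u v) *
        (bmoExpNormMulLpConst p a K₀ K₀' K K' * eLpNorm X (ENNReal.ofReal b) P) := by
  refine (eLpNorm_condLpNorm_mul_mul_le_of_measurable hq habc (𝓕.le u)
    ((measurable_expNorm hV.adapted u).mul (measurable_expNorm hV'.adapted u)) hX
    (((measurable_expIncrement hV'.adapted 1 huv.le le_rfl).mono (𝓕.le v) le_rfl).mul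
      (measurable_enorm_sub hV'.adapted u v)).aemeasurable
    (hV'.condLpNorm_expIncrement_mul_enorm_sub_le h𝓕 hs ht hp hK' hq huv)).trans ?_
  gcongr
  exact hV.eLpNorm_expNorm_mul_expNorm_le hV' h𝓕 hs ht hp h₀ h₀' hK hK' habc.pos u

end ExpMoments

section InitialValue

variable {ι Ω E : Type*} [LinearOrder ι] {mΩ : MeasurableSpace Ω} {𝓕 : Filtration ι mΩ}
  {P : Measure Ω} [IsProbabilityMeasure P] [NormedAddCommGroup E] {p q r : ℝ} {s t u : ι}

theorem eLpNorm_le_condNorm {m : MeasurableSpace Ω} (hm : m ≤ mΩ) (hq : 0 < q) (hr : 1 ≤ r)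
    (Y : Ω → E) : eLpNorm Y (ENNReal.ofReal q) P ≤ condNorm P q (ENNReal.ofReal r) m Y := by
  rw [condNorm_eq_eLpNorm_condLpNorm hq (zero_le_one.trans hr), ← eLpNorm_enorm,
    ← eLpNorm_condLpNorm hm hq]
  refine eLpNorm_le_eLpNorm_of_exponent_le
    (ENNReal.ofReal_le_ofReal (le_mul_of_one_le_left hq.le hr)) ?_
  exact ((measurable_condLpNorm P q m _).mono hm le_rfl).aestronglyMeasurable

theorem eLpNorm_le_add_pqrNorm {D : ι → Ω → E} (hD : ∀ u, AEStronglyMeasurable (D u) P)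
    (hp : 0 < p) (hq : 1 ≤ q) (hr : 1 ≤ r) (hsu : s ≤ u) (hut : u ≤ t) :
    eLpNorm (D u) (ENNReal.ofReal q) P ≤ eLpNorm (D s) (ENNReal.ofReal q) P +
      pqrNorm 𝓕 P p q (ENNReal.ofReal r) (increment D) s t := by
  rcases hsu.eq_or_lt with rfl | hlt
  · exact le_self_add
  have increment_le : eLpNorm (increment D s u) (ENNReal.ofReal q) P ≤
      pqrNorm 𝓕 P p q (ENNReal.ofReal r) (increment D) s t :=
    (eLpNorm_le_condNorm (𝓕.le s) (zero_lt_one.trans_le hq) hr _).trans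
      (le_pVariation_of_mem (w := fun u v => condNorm P q (ENNReal.ofReal r) (𝓕 u)
        (increment D u v)) hp le_rfl hlt hut)
  calc eLpNorm (D u) (ENNReal.ofReal q) P
      = eLpNorm (D s + increment D s u) (ENNReal.ofReal q) P := by
        congr 1
        exact funext fun ω => (add_sub_cancel _ _).symm
    _ ≤ eLpNorm (D s) (ENNReal.ofReal q) P + eLpNorm (increment D s u) (ENNReal.ofReal q) P :=
        eLpNorm_add_le (hD s) ((hD u).sub (hD s)) (ENNReal.one_le_ofReal.2 hq)
    _ ≤ _ := by gcongr

end InitialValue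

section ExpDifference

variable {ι Ω : Type*} [LinearOrder ι] {mΩ : MeasurableSpace Ω} {𝓕 : Filtration ι mΩ}
  {P : Measure Ω} {V V' : ι → Ω → ℝ} {p q q' r : ℝ} {s t u v : ι}

theorem eLpNorm_condLpNorm_increment_exp_sub_exp_le (hV : StronglyAdapted 𝓕 V)
    (hV' : StronglyAdapted 𝓕 V') (hq' : 1 ≤ q') {e : ℝ≥0∞} (he : 1 ≤ e) (huv : u ≤ v) :
    eLpNorm (condLpNorm P q' (𝓕 u) fun ω =>
        ‖increment (fun t ω => Real.exp (V t ω) - Real.exp (V' t ω)) u v ω‖ₑ) e P ≤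
      2 * (eLpNorm (condLpNorm P q' (𝓕 u) (expNorm V u * expNorm V' u *
            (expIncrement 1 V u v * expIncrement 1 V' u v * fun ω =>
              ‖increment (fun t ω => V t ω - V' t ω) u v ω‖ₑ))) e P +
          eLpNorm (condLpNorm P q' (𝓕 u) (expNorm V u * expNorm V' u *
            ((fun ω => ‖V u ω - V' u ω‖ₑ) *
              (expIncrement 1 V' u v * fun ω => ‖V' v ω - V' u ω‖ₑ)))) e P) := by
  have meas_exp : ∀ {U : ι → Ω → ℝ}, StronglyAdapted 𝓕 U → Measurable (expIncrement 1 U u v) :=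
    fun hU => (measurable_expIncrement hU 1 huv le_rfl).mono (𝓕.le v) le_rfl
  have meas_weight : ∀ {U : ι → Ω → ℝ}, StronglyAdapted 𝓕 U → Measurable (expNorm U u) :=
    fun hU => (measurable_expNorm hU u).mono (𝓕.le u) le_rfl
  have meas_D : Measurable fun ω => ‖increment (fun t ω => V t ω - V' t ω) u v ω‖ₑ :=
    measurable_enorm_sub (fun u => (hV u).sub (hV' u)) u v
  refine le_trans ?_ (eLpNorm_condLpNorm_add_le (𝓕.le u) hq' (((meas_weight hV).mul
    (meas_weight hV')).mul (((meas_exp hV).mul (meas_exp hV')).mul meas_D)).aemeasurable he)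
  rw [← mul_add]
  exact eLpNorm_mono_enorm_ae (condLpNorm_mono (zero_le_one.trans hq')
    (Eventually.of_forall (enorm_increment_exp_sub_exp_le V V' u v)))

/-- The constant in `MemBMOVar.condNorm_increment_exp_sub_exp_le`. Its summands come from the two
terms in `enorm_increment_exp_sub_exp_le`: in each of them, one factor comes from Hölder's
inequality for the weight `exp |V_u| exp |V'_u|`, the other one from the conditional Hölder
inequality for the exponentials of the increments. -/
def expDiffConst (p q q' r : ℝ) (K₀ K₀' K K' : ℝ≥0) : ℝ≥0∞ :=
  2 * (bmoExpLpConst p (2 * holderComplement q q') K *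
        bmoExpLpConst p (2 * holderComplement q q') K' *
        bmoExpNormMulLpConst p (holderComplement (r * q) (r * q')) K₀ K₀' K K' +
    bmoExpLpConst p (2 * q') K' * momentConst (2 * q') *
      bmoExpNormMulLpConst p (holderComplement q (r * q')) K₀ K₀' K K')

theorem expDiffConst_ne_top (p : ℝ) (hq' : 1 ≤ q') (hr : 1 ≤ r) (hqq' : q' * r < q)
    (K₀ K₀' K K' : ℝ≥0) : expDiffConst p q q' r K₀ K₀' K K' ≠ ∞ := by
  have hq'₀ : 0 < q' := zero_lt_one.trans_le hq'
  have hrq' : 0 < r * q' := mul_pos (zero_lt_one.trans_le hr) hq'₀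
  have h := (holderTriple_holderComplement hq'₀ (show q' < q by nlinarith)).nonneg
  have h₁ := (holderTriple_holderComplement hrq' (show r * q' < r * q by nlinarith)).nonneg
  have h₂ := (holderTriple_holderComplement hrq' (show r * q' < q by nlinarith)).nonneg
  refine ENNReal.mul_ne_top ENNReal.ofNat_ne_top (ENNReal.add_ne_top.2
    ⟨ENNReal.mul_ne_top (ENNReal.mul_ne_top ?_ ?_) (bmoExpNormMulLpConst_ne_top p h₁ K₀ K₀' K K'),
      ENNReal.mul_ne_top (ENNReal.mul_ne_top ?_ ?_) (bmoExpNormMulLpConst_ne_top p h₂ K₀ K₀' K K')⟩)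
  · exact bmoExpLpConst_ne_top p (by positivity) K
  · exact bmoExpLpConst_ne_top p (by positivity) K'
  · exact bmoExpLpConst_ne_top p (by positivity) K'
  · exact momentConst_ne_top (by positivity)

variable [TopologicalSpace ι] [OrderTopology ι] [DenselyOrdered ι] [SecondCountableTopology ι]
  [CompactSpace ι] [IsProbabilityMeasure P] {K K' K₀ K₀' : ℝ≥0}

theorem MemBMOVar.condNorm_increment_exp_sub_exp_le (hV : MemBMOVar 𝓕 P p V s t)
    (hV' : MemBMOVar 𝓕 P p V' s t) (h𝓕 : UsualConditions 𝓕 P) (hs : IsBot s) (ht : IsTop t)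
    (hp : 0 < p) (h₀ : eLpNorm (V s) ∞ P ≤ K₀) (h₀' : eLpNorm (V' s) ∞ P ≤ K₀')
    (hK : bmoVarNorm 𝓕 P p V s t ≤ K) (hK' : bmoVarNorm 𝓕 P p V' s t ≤ K') (hq' : 1 ≤ q')
    (hr : 1 ≤ r) (hqq' : q' * r < q) (huv : u < v) :
    condNorm P q' (ENNReal.ofReal r) (𝓕 u)
        (increment (fun t ω => Real.exp (V t ω) - Real.exp (V' t ω)) u v) ≤
      expDiffConst p q q' r K₀ K₀' K K' *
        (condNorm P q (ENNReal.ofReal r) (𝓕 u) (increment (fun t ω => V t ω - V' t ω) u v) +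
          meanVariation 𝓕 P V' u v *
            eLpNorm (fun ω => V u ω - V' u ω) (ENNReal.ofReal q) P) := by
  have hq'₀ : 0 < q' := zero_lt_one.trans_le hq'
  have hrq' : 1 ≤ r * q' := one_le_mul_of_one_le_of_one_le hr hq'
  have hrq'₀ : 0 < r * q' := zero_lt_one.trans_le hrq'
  have holder := holderTriple_holderComplement hq'₀ (show q' < q by nlinarith)
  have holder₁ := holderTriple_holderComplement hrq'₀ (show r * q' < r * q by nlinarith)
  have holder₂ := holderTriple_holderComplement hrq'₀ (show r * q' < q by nlinarith)
  have adapted_D : StronglyAdapted 𝓕 fun t ω => V t ω - V' t ω :=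
    fun u => (hV.adapted u).sub (hV'.adapted u)
  set X : Ω → ℝ≥0∞ := fun ω => ‖increment (fun t ω => V t ω - V' t ω) u v ω‖ₑ
  have hX : Measurable X := measurable_enorm_sub adapted_D u v
  rw [condNorm_eq_eLpNorm_condLpNorm hq'₀ (zero_le_one.trans hr),
    condNorm_eq_eLpNorm_condLpNorm (by nlinarith) (zero_le_one.trans hr),
    ← eLpNorm_enorm (fun ω => V u ω - V' u ω)]
  set ρ := meanVariation 𝓕 P V' u v
  set N₁ := eLpNorm (condLpNorm P q (𝓕 u) X) (ENNReal.ofReal (r * q)) P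
  set N₂ := eLpNorm (fun ω => ‖V u ω - V' u ω‖ₑ) (ENNReal.ofReal q) P
  refine (eLpNorm_condLpNorm_increment_exp_sub_exp_le hV.adapted hV'.adapted hq'
    (ENNReal.one_le_ofReal.2 hrq') huv.le).trans ?_
  rw [expDiffConst, mul_assoc (2 : ℝ≥0∞), add_mul]
  refine mul_le_mul_right (add_le_add ?_ ?_) 2
  · refine (hV.eLpNorm_condLpNorm_mul_expIncrement_mul_le hV' h𝓕 hs ht hp h₀ h₀' hK hK' holder
      holder₁ huv.le hX.aemeasurable).trans ?_
    rw [← mul_assoc]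
    exact mul_le_mul_right le_self_add _
  · refine (hV.eLpNorm_condLpNorm_mul_mul_enorm_sub_le hV' h𝓕 hs ht hp h₀ h₀' hK hK' hq'₀
      holder₂ huv (adapted_D u).enorm).trans ?_
    refine le_trans (le_of_eq ?_) (mul_le_mul_right (le_add_self (a := ρ * N₂)) _)
    ring

theorem MemBMOVar.pqrNorm_increment_exp_sub_exp_le (hV : MemBMOVar 𝓕 P p V s t)
    (hV' : MemBMOVar 𝓕 P p V' s t) (h𝓕 : UsualConditions 𝓕 P) (hs : IsBot s) (ht : IsTop t)
    (hp : 1 ≤ p) (h₀ : eLpNorm (V s) ∞ P ≤ K₀) (h₀' : eLpNorm (V' s) ∞ P ≤ K₀')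
    (hK : bmoVarNorm 𝓕 P p V s t ≤ K) (hK' : bmoVarNorm 𝓕 P p V' s t ≤ K') (hq' : 1 ≤ q')
    (hr : 1 ≤ r) (hqq' : q' * r < q) :
    pqrNorm 𝓕 P p q' (ENNReal.ofReal r)
        (increment fun t ω => Real.exp (V t ω) - Real.exp (V' t ω)) s t ≤
      expDiffConst p q q' r K₀ K₀' K K' * (1 + K') *
        (eLpNorm (fun ω => V s ω - V' s ω) (ENNReal.ofReal q) P +
          pqrNorm 𝓕 P p q (ENNReal.ofReal r) (increment fun t ω => V t ω - V' t ω) s t) := by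
  have hp₀ : 0 < p := zero_lt_one.trans_le hp
  have hq : 1 ≤ q := by nlinarith
  set D : ι → Ω → ℝ := fun t ω => V t ω - V' t ω
  have meas_D : ∀ u, AEStronglyMeasurable (D u) P := fun u =>
    (((hV.adapted u).sub (hV'.adapted u)).mono (𝓕.le u)).aestronglyMeasurable
  set C := expDiffConst p q q' r K₀ K₀' K K'
  set N := pqrNorm 𝓕 P p q (ENNReal.ofReal r) (increment D) s t
  set N₀ := eLpNorm (D s) (ENNReal.ofReal q) P
  have interval_le : ∀ u v, s ≤ u → u < v → v ≤ t → condNorm P q' (ENNReal.ofReal r) (𝓕 u)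
      (increment (fun t ω => Real.exp (V t ω) - Real.exp (V' t ω)) u v) ≤
        C * (condNorm P q (ENNReal.ofReal r) (𝓕 u) (increment D u v) +
          (N₀ + N) * meanVariation 𝓕 P V' u v) := fun u v hsu huv hvt => by
    refine (hV.condNorm_increment_exp_sub_exp_le hV' h𝓕 hs ht hp₀ h₀ h₀' hK hK' hq' hr hqq'
      huv).trans ?_
    rw [mul_comm (meanVariation 𝓕 P V' u v)]
    exact mul_le_mul_right (add_le_add le_rfl (mul_le_mul_left
      (eLpNorm_le_add_pqrNorm meas_D hp₀ hq hr hsu (huv.le.trans hvt)) _)) C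
  calc pqrNorm 𝓕 P p q' (ENNReal.ofReal r)
        (increment fun t ω => Real.exp (V t ω) - Real.exp (V' t ω)) s t
      ≤ C * (N + (N₀ + N) * bmoVarNorm 𝓕 P p V' s t) :=
        pVariation_le_mul_add_mul_of_le hp interval_le
    _ ≤ C * ((N₀ + N) + (N₀ + N) * K') :=
        mul_le_mul_right (add_le_add le_add_self (mul_le_mul_right hK' _)) C
    _ = C * (1 + K') * (N₀ + N) := by ring

end ExpDifference

section Exp

variable {ι Ω E : Type*} [LinearOrder ι] {mΩ : MeasurableSpace Ω} {𝓕 : Filtration ι mΩ}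
  {P : Measure Ω} [NormedAddCommGroup E] {p q r : ℝ} {s t : ι}

theorem memLp_exp_of_memLp_top [IsFiniteMeasure P] {f : Ω → ℝ} (hf : MemLp f ∞ P) (e : ℝ≥0∞) :
    MemLp (fun ω => Real.exp (f ω)) e P := by
  refine MemLp.of_bound (Real.continuous_exp.comp_aestronglyMeasurable hf.1)
    (Real.exp (eLpNorm f ∞ P).toReal) ?_
  rw [eLpNorm_exponent_top]
  filter_upwards [enorm_ae_le_eLpNormEssSup f P] with ω hω
  rw [Real.norm_eq_abs, Real.abs_exp]
  refine Real.exp_le_exp.2 ((le_abs_self _).trans ?_)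
  rw [← Real.norm_eq_abs, ← toReal_enorm]
  exact ENNReal.toReal_mono (eLpNorm_exponent_top (f := f) (μ := P) ▸ hf.2.ne) hω

variable [TopologicalSpace ι] [OrderTopology ι] [DenselyOrdered ι] [SecondCountableTopology ι]
  [CompactSpace ι] [IsProbabilityMeasure P]

theorem MemBMOVar.pqrNorm_increment_le {V : ι → Ω → E} (hV : MemBMOVar 𝓕 P p V s t)
    (h𝓕 : UsualConditions 𝓕 P) (hs : IsBot s) (ht : IsTop t) (hp : 0 < p) (hq : 0 < q)
    (hr : 0 < r) :
    pqrNorm 𝓕 P p q (ENNReal.ofReal r) (increment V) s t ≤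
      momentConst q * bmoVarNorm 𝓕 P p V s t := by
  refine (pVariation_mono hp fun u v _ huv _ => ?_).trans (pVariation_const_mul_le hp _)
  rw [condNorm_eq_eLpNorm_condLpNorm hq hr.le]
  exact eLpNorm_le_of_ae_le_const (hV.condLpNorm_enorm_sub_le h𝓕 hs ht hp hq huv)

theorem MemBMOVar.pqrNorm_increment_exp_lt_top {V : ι → Ω → ℝ} (hV : MemBMOVar 𝓕 P p V s t)
    (h𝓕 : UsualConditions 𝓕 P) (hs : IsBot s) (ht : IsTop t) (hp : 1 ≤ p) (h₀ : MemLp (V s) ∞ P)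
    (hq : 1 ≤ q) (hr : 1 ≤ r) :
    pqrNorm 𝓕 P p q (ENNReal.ofReal r) (increment fun t ω => Real.exp (V t ω)) s t < ∞ := by
  have hp₀ : 0 < p := zero_lt_one.trans_le hp
  have le_bound := hV.pqrNorm_increment_exp_sub_exp_le (memBMOVar_zero 𝓕 P hp₀ s t) h𝓕 hs ht hp
    (K₀' := 0) (K' := 0) (ENNReal.coe_toNNReal h₀.2.ne).ge eLpNorm_zero.le
    (ENNReal.coe_toNNReal hV.norm_lt_top.ne).ge (bmoVarNorm_zero 𝓕 P hp₀ s t).le hq hr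
    (lt_add_one (q * r))
  have increment_sub_one : (increment fun t ω => Real.exp (V t ω) - Real.exp 0) =
      increment fun t ω => Real.exp (V t ω) := by
    ext u v ω
    exact sub_sub_sub_cancel_right _ _ _
  simp only [sub_zero, increment_sub_one] at le_bound
  refine le_bound.trans_lt (ENNReal.mul_lt_top (ENNReal.mul_lt_top
    (expDiffConst_ne_top p hq hr (lt_add_one _) _ _ _ _).lt_top (by simp))
    (ENNReal.add_lt_top.2 ⟨(h₀.mono_exponent le_top).2, ?_⟩))
  exact (hV.pqrNorm_increment_le h𝓕 hs ht hp₀ (by positivity) (by positivity)).trans_lt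
    (ENNReal.mul_lt_top (momentConst_ne_top (by positivity)).lt_top hV.norm_lt_top)

theorem MemBMOVar.memVpLqr_exp {V : ι → Ω → ℝ} (hV : MemBMOVar 𝓕 P p V s t)
    (h𝓕 : UsualConditions 𝓕 P) (hs : IsBot s) (ht : IsTop t) (hp : 1 ≤ p) (h₀ : MemLp (V s) ∞ P)
    (hq : 1 ≤ q) (hr : 1 ≤ r) :
    MemVpLqr 𝓕 P p q (ENNReal.ofReal r) (fun t ω => Real.exp (V t ω)) s t where
  measurable u := Real.continuous_exp.comp_stronglyMeasurable ((hV.adapted u).mono (𝓕.le u))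
  cadlag := hV.cadlag.mono fun _ hω => hω.continuous_comp Real.continuous_exp
  initial := memLp_exp_of_memLp_top h₀ _
  norm_lt_top := hV.pqrNorm_increment_exp_lt_top h𝓕 hs ht hp h₀ hq hr

end Exp

end RoughBMO

end

theorem mainTheorem12 (p : ℝ) (hp : 1 ≤ p) :
    (∀ (T : ℝ) (hT : 0 < T) (Ω : Type u) [mΩ : MeasurableSpace Ω] (P : Measure Ω)
        [IsProbabilityMeasure P] (𝓕 : Filtration (Icc (0 : ℝ) T) mΩ),
        RoughBMO.UsualConditions 𝓕 P →
      ∀ V : Icc (0 : ℝ) T → Ω → ℝ,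
        RoughBMO.MemBMOVar 𝓕 P p V (RoughBMO.startTime hT) (RoughBMO.endTime hT) →
        MemLp (V (RoughBMO.startTime hT)) ∞ P →
      ∀ q r : ℝ, 1 ≤ q → 1 ≤ r →
        RoughBMO.MemVpLqr 𝓕 P p q (ENNReal.ofReal r) (fun t ω => Real.exp (V t ω))
          (RoughBMO.startTime hT) (RoughBMO.endTime hT)) ∧
    (∀ q q' r : ℝ, 1 ≤ q → 1 ≤ q' → 1 ≤ r → q' * r < q →
      ∀ K₀ K₀' K K' : ℝ≥0, ∃ C : ℝ≥0, 0 < C ∧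
      ∀ (T : ℝ) (hT : 0 < T) (Ω : Type u) [mΩ : MeasurableSpace Ω] (P : Measure Ω)
        [IsProbabilityMeasure P] (𝓕 : Filtration (Icc (0 : ℝ) T) mΩ),
        RoughBMO.UsualConditions 𝓕 P →
      ∀ V V' : Icc (0 : ℝ) T → Ω → ℝ,
        RoughBMO.MemBMOVar 𝓕 P p V (RoughBMO.startTime hT) (RoughBMO.endTime hT) →
        RoughBMO.MemBMOVar 𝓕 P p V' (RoughBMO.startTime hT) (RoughBMO.endTime hT) →
        eLpNorm (V (RoughBMO.startTime hT)) ∞ P ≤ K₀ →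
        eLpNorm (V' (RoughBMO.startTime hT)) ∞ P ≤ K₀' →
        RoughBMO.bmoVarNorm 𝓕 P p V (RoughBMO.startTime hT) (RoughBMO.endTime hT) ≤ K →
        RoughBMO.bmoVarNorm 𝓕 P p V' (RoughBMO.startTime hT) (RoughBMO.endTime hT) ≤ K' →
        RoughBMO.pqrNorm 𝓕 P p q' (ENNReal.ofReal r)
            (RoughBMO.increment fun t ω => Real.exp (V t ω) - Real.exp (V' t ω))
            (RoughBMO.startTime hT) (RoughBMO.endTime hT) ≤
          C * (eLpNorm (fun ω => V (RoughBMO.startTime hT) ω - V' (RoughBMO.startTime hT) ω)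
                (ENNReal.ofReal q) P +
              RoughBMO.pqrNorm 𝓕 P p q (ENNReal.ofReal r)
                (RoughBMO.increment fun t ω => V t ω - V' t ω)
                (RoughBMO.startTime hT) (RoughBMO.endTime hT))) := by
  have isBot_startTime : ∀ {T : ℝ} (hT : 0 < T), IsBot (RoughBMO.startTime hT) :=
    fun _ u => u.2.1
  have isTop_endTime : ∀ {T : ℝ} (hT : 0 < T), IsTop (RoughBMO.endTime hT) :=
    fun _ u => u.2.2
  refine ⟨fun T hT Ω _ P _ 𝓕 h𝓕 V hV h₀ q r hq hr =>
    hV.memVpLqr_exp h𝓕 (isBot_startTime hT) (isTop_endTime hT) hp h₀ hq hr,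
    fun q q' r _ hq' hr hqq' K₀ K₀' K K' => ?_⟩
  set C := RoughBMO.expDiffConst p q q' r K₀ K₀' K K' * (1 + K')
  have C_ne_top : C ≠ ∞ :=
    ENNReal.mul_ne_top (RoughBMO.expDiffConst_ne_top p hq' hr hqq' K₀ K₀' K K') (by simp)
  refine ⟨C.toNNReal + 1, by positivity,
    fun T hT Ω _ P _ 𝓕 h𝓕 V V' hV hV' h₀ h₀' hK hK' => ?_⟩
  refine (hV.pqrNorm_increment_exp_sub_exp_le hV' h𝓕 (isBot_startTime hT) (isTop_endTime hT) hp
    h₀ h₀' hK hK' hq' hr hqq').trans (mul_le_mul_left ?_ _)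
  rw [ENNReal.coe_add, ENNReal.coe_toNNReal C_ne_top]
  exact le_self_add
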